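/- Let $\mathbb F\in\{\mathbb R,\mathbb C\}$. An effective Banach space is a Banach space $X$ over $\mathbb F$ with a Pour-El--Richards computability structure (a nonempty set of "computable" sequences in $X$ satisfying the linear forms, limit and norm axioms) and a computable sequence $(e_n)$ whose linear span is dense. Let $X_k$ be the set of computable elements, i.e. those $x$ for which the constant sequence $(x,x,\dots)$ is computable. Let $(a_n)$ be the standard enumeration of all finite linear combinations of the $e_i$ with coefficients in $\mathbb Q$ (in $\mathbb Q+i\mathbb Q$ if $\mathbb F=\mathbb C$), and $(\varphi_m)$ the standard enumeration of the partial recursive functions. The standard numbering $\alpha$ of $X_k$ is given by $\alpha m=x$ iff $\varphi_m$ is total and $\|a_{\varphi_m(n)}-x\|<2^{-n}$ for all $n$. A partially defined operator $T$ from $X$ to $X$ with $X_k\subseteq\operatorname{dom}T$, linear over the computable scalars (the domain may be $X_k$ itself, a subspace containing $X_k$, or $X$), is called effective if there is a partial recursive $\varphi$ with $T\alpha m=\alpha\varphi(m)$ for all $m\in\operatorname{dom}\alpha$, and if $T$ is determined by its values on $X_k$ in the sense that for each $x\in\operatorname{dom}T$ there are $x_n\in X_k$ with $x_n\to x$ and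 $Tx_n\to Tx$ (a void condition if $\operatorname{dom}T=X_k$). For $Z\subseteq X$, $T$ is closed on $Z$ if $x_n\in\operatorname{dom}T$, $x_n\to x\in Z$ and $Tx_n\to y$ imply $x\in\operatorname{dom}T$ and $Tx=y$. Theorem 41 (Closed operators). Let $X$ be an effective Banach space. Every effective operator $T$ is closed on $X_k$, and it is closed on $X$ if it is totally defined ($\operatorname{dom}T=X$). Hence an effective operator that is not closed on $X$ is not totally defined. Such operators exist: if $X$ is infinite-dimensional, then the identity with domain $\operatorname{span}_{\mathbb F}(X_k)$ is effective, not closed on $X$, and not totally defined; and there are effective Banach spaces over $\mathbb R$ and over $\mathbb C$ for which this happens. -/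

import Mathlib

open Filter Topology

universe u v

noncomputable section

namespace EffectiveBanach

/-! Computable sequences of reals and of scalars. -/

/-- The standard numbering of the rational numbers: a code for `(p, q, r)` names `(p - q) / (r + 1)`. -/
def ratOf (n : ℕ) : ℚ :=
  ((n.unpair.1.unpair.1 : ℚ) - (n.unpair.1.unpair.2 : ℚ)) / ((n.unpair.2 : ℚ) + 1)

/-- A computable sequence of real numbers: approximable by rationals, uniformly recursively. -/
def IsComputableRealSeq (x : ℕ → ℝ) : Prop :=
  ∃ r : ℕ → ℕ → ℕ, Computable₂ r ∧ ∀ n k, |x n - (ratOf (r n k) : ℝ)| < (2⁻¹ : ℝ) ^ k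

section Scalars

variable {𝕜 : Type*} [RCLike 𝕜]

/-- A computable sequence of scalars: real and imaginary parts are computable sequences. -/
def IsComputableScalarSeq (c : ℕ → 𝕜) : Prop :=
  IsComputableRealSeq (fun n => RCLike.re (c n)) ∧ IsComputableRealSeq (fun n => RCLike.im (c n))

/-- A computable double sequence of scalars. -/
def IsComputableScalarSeq₂ (c : ℕ → ℕ → 𝕜) : Prop :=
  IsComputableScalarSeq (fun m => c m.unpair.1 m.unpair.2)

/-- A computable scalar. -/
def IsComputableScalar (c : 𝕜) : Prop :=
  IsComputableScalarSeq (fun _ => c)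

/-- The numbering of the rational scalars (`ℚ` in the real case, `ℚ + iℚ` in the complex case;
in the real case `RCLike.I = 0`). -/
def scalarOf (𝕜 : Type*) [RCLike 𝕜] (n : ℕ) : 𝕜 :=
  (ratOf n.unpair.1 : 𝕜) + (ratOf n.unpair.2 : 𝕜) * RCLike.I

end Scalars

/-- A computability structure (Pour-El and Richards) on a normed space: a nonempty set of
sequences, called the computable sequences, subject to the linear forms axiom, the limit axiom
and the norm axiom. -/
structure ComputabilityStructure (𝕜 X : Type*) [RCLike 𝕜] [NormedAddCommGroup X]
    [NormedSpace 𝕜 X] where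
  seqs : Set (ℕ → X)
  nonempty : seqs.Nonempty
  linear_mem : ∀ x ∈ seqs, ∀ y ∈ seqs, ∀ a b : ℕ → ℕ → 𝕜,
    IsComputableScalarSeq₂ a → IsComputableScalarSeq₂ b → ∀ d : ℕ → ℕ, Computable d →
      (fun n => ∑ k ∈ Finset.range (d n + 1), (a n k • x k + b n k • y k)) ∈ seqs
  limit_mem : ∀ (x : ℕ → ℕ → X) (y : ℕ → X), (fun m => x m.unpair.1 m.unpair.2) ∈ seqs →
    (∃ g : ℕ → ℕ → ℕ, Computable₂ g ∧
      ∀ n N k, g n N ≤ k → ‖x n k - y n‖ ≤ (2⁻¹ : ℝ) ^ N) → y ∈ seqs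
  norm_computable : ∀ x ∈ seqs, IsComputableRealSeq (fun n => ‖x n‖)

section Space

variable {𝕜 X : Type*} [RCLike 𝕜] [NormedAddCommGroup X] [NormedSpace 𝕜 X]

/-- The set `X_k` of computable elements. -/
def ComputabilityStructure.elements (S : ComputabilityStructure 𝕜 X) : Set X :=
  {x | (fun _ => x) ∈ S.seqs}

/-- An effectively generating set: a computable sequence whose linear span is dense.  A Banach
space with a computability structure that has such a sequence is an effective Banach space. -/
def ComputabilityStructure.IsGenerating (S : ComputabilityStructure 𝕜 X) (e : ℕ → X) : Prop :=
  e ∈ S.seqs ∧ Dense (Submodule.span 𝕜 (Set.range e) : Set X)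

/-- The numbering `n ↦ a_n` of the rational span of `e`: the number `n` codes a finite list of
rational scalars, the coefficients of `e 0, e 1, …`. -/
def ratSpan (𝕜 : Type*) {X : Type*} [RCLike 𝕜] [NormedAddCommGroup X] [NormedSpace 𝕜 X]
    (e : ℕ → X) (n : ℕ) : X :=
  ∑ i ∈ Finset.range (Denumerable.ofNat (List ℕ) n).length,
    scalarOf 𝕜 ((Denumerable.ofNat (List ℕ) n).getD i 0) • e i

/-- The standard enumeration `φ_0, φ_1, …` of the partial recursive functions. -/
def phi (n : ℕ) : ℕ →. ℕ :=
  (Denumerable.ofNat Nat.Partrec.Code n).eval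

/-- The standard numbering `α`, as a relation: `n ∈ dom α` and `α n = x`, that is, `φ_n` is total
and `‖a_{φ_n(k)} - x‖ < 2^{-k}` for all `k` (so `x` is the limit of these elements). -/
def IsIndex (𝕜 : Type*) {X : Type*} [RCLike 𝕜] [NormedAddCommGroup X] [NormedSpace 𝕜 X]
    (e : ℕ → X) (n : ℕ) (x : X) : Prop :=
  ∀ k, ∃ m ∈ phi n k, ‖ratSpan 𝕜 e m - x‖ < (2⁻¹ : ℝ) ^ k

/-- An effective operator: a partial map `T` of `X` that is linear (for computable scalars, so
that `X_k` itself is a possible domain), is defined on all computable elements and acts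
effectively on their standard indices, and is determined by its values on `X_k`: every point of
its graph is a limit of points of the graph over `X_k`. -/
structure IsEffectiveOperator (S : ComputabilityStructure 𝕜 X) (e : ℕ → X) (T : X →. X) :
    Prop where
  linear : ∀ c d : 𝕜, IsComputableScalar c → IsComputableScalar d → ∀ x x' y y' : X,
    y ∈ T x → y' ∈ T x' → c • y + d • y' ∈ T (c • x + d • x')
  effective : ∃ f : ℕ →. ℕ, Nat.Partrec f ∧ ∀ n x, IsIndex 𝕜 e n x →
    ∃ m ∈ f n, ∃ y ∈ T x, IsIndex 𝕜 e m y
  determined : T.graph ⊆ closure {p : X × X | p.1 ∈ S.elements ∧ p.2 ∈ T p.1}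

/-- `T` is closed on `Z`: if `x_n ∈ dom T`, `x_n → x ∈ Z` and `T x_n → y`, then `x ∈ dom T` and
`T x = y`.  For `Z = X` this says that the graph of `T` is closed. -/
def IsClosedOn (T : X →. X) (Z : Set X) : Prop :=
  ∀ (u v : ℕ → X) (x y : X), (∀ n, v n ∈ T (u n)) → x ∈ Z →
    Tendsto u atTop (𝓝 x) → Tendsto v atTop (𝓝 y) → y ∈ T x

/-- The identity with domain the linear span of the computable elements. -/
def idOnSpan (S : ComputabilityStructure 𝕜 X) : X →. X :=
  PFun.res id (Submodule.span 𝕜 S.elements : Set X)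

end Space

end EffectiveBanach

end

open scoped ZeroAtInfty

noncomputable section

namespace EffectiveBanach

/-! The core is a continuity principle, `IsEffectiveOperator.exists_norm_sub_lt`. Let a computable
`b` name `x` and suppose the values of `T` at the approximants stay at distance at least `ε` from `T
x`. For a program `c`, run through `b` until `c` halts and repeat the current approximant from then
on. This names `x` if `c` never halts, and an approximant otherwise. Since `T` acts on indices, a
good approximation to its value can be computed from `c`, and it tells the two cases apart: the
halting problem would be decidable.

Linearity turns this into boundedness near `0`. If `T` took large values at arbitrarily small
rational combinations, a search would find a computable name of `0` along which the values stay away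
from `T 0 = 0` (`exists_bound_ratSpan`). The continuity principle carries the bound over to all
computable elements (`exists_bound_elements`). By scaling, the closure of the graph over `X_k` is
then single-valued (`eq_of_mem_closure`). It contains the whole graph of `T`, so a limit of graph
points over a point of `dom T` lies on the graph. Both closedness claims follow.

For the identity on the span of `X_k`, density of `X_k` shows that closedness would force the domain
to be `X`. But `X_k` is countable, and by Baire a Banach space with a countable spanning set is
finite-dimensional. The space of null sequences serves as the example over both fields. -/

theorem computable_two_pow {α : Type*} [Primcodable α] {f : α → ℕ} (hf : Computable f) :
    Computable fun a => 2 ^ f a := by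
  have h : Computable fun n : ℕ => 2 ^ n := by
    refine (Computable.nat_rec (α := ℕ) (σ := ℕ) Computable.id (Computable.const 1)
      (h := fun _ p => p.2 + p.2) ?_).of_eq fun n => ?_
    · exact (Primrec.nat_add.comp (Primrec.snd.comp Primrec.snd)
        (Primrec.snd.comp Primrec.snd)).to_comp.to₂
    · induction n with
      | zero => rfl
      | succ n ih => simp only [id] at ih ⊢; rw [ih, pow_succ]; omega
  exact h.comp hf

/-! ### Closure properties of computable functions and predicates. -/

section Arithmetic

variable {α : Type*} [Primcodable α] {f g : α → ℕ}

theorem computable_add (hf : Computable f) (hg : Computable g) : Computable fun a => f a + g a :=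
  Primrec.nat_add.to_comp.comp hf hg

theorem computable_sub (hf : Computable f) (hg : Computable g) : Computable fun a => f a - g a :=
  Primrec.nat_sub.to_comp.comp hf hg

theorem computable_mul (hf : Computable f) (hg : Computable g) : Computable fun a => f a * g a :=
  Primrec.nat_mul.to_comp.comp hf hg

theorem computable_div (hf : Computable f) (hg : Computable g) : Computable fun a => f a / g a :=
  Primrec.nat_div.to_comp.comp hf hg

theorem computable_unpair_fst (hf : Computable f) : Computable fun a => (f a).unpair.1 :=
  Computable.fst.comp (Computable.unpair.comp hf)

theorem computable_unpair_snd (hf : Computable f) : Computable fun a => (f a).unpair.2 :=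
  Computable.snd.comp (Computable.unpair.comp hf)

theorem computable_pair (hf : Computable f) (hg : Computable g) :
    Computable fun a => Nat.pair (f a) (g a) :=
  Primrec₂.natPair.to_comp.comp hf hg

theorem computable_sum {d : α → ℕ} {F : α → ℕ → ℕ} (hd : Computable d) (hF : Computable₂ F) :
    Computable fun a => ∑ i ∈ Finset.range (d a), F a i := by
  refine (Computable.nat_rec (σ := ℕ) hd (Computable.const 0)
    (h := fun a p => p.2 + F a p.1) ?_).of_eq fun a => ?_
  · exact computable_add (Computable.snd.comp Computable.snd)
      (hF.comp Computable.fst (Computable.fst.comp Computable.snd))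
  · induction d a with
    | zero => simp
    | succ n ih => simp only at ih ⊢; rw [ih, Finset.sum_range_succ]

theorem computable_sup {d : α → ℕ} {F : α → ℕ → ℕ} (hd : Computable d) (hF : Computable₂ F) :
    Computable fun a => (Finset.range (d a)).sup (F a) := by
  refine (Computable.nat_rec (σ := ℕ) hd (Computable.const 0)
    (h := fun a p => max (F a p.1) p.2) ?_).of_eq fun a => ?_
  · exact Primrec.nat_max.to_comp.comp (hF.comp Computable.fst (Computable.fst.comp Computable.snd))
      (Computable.snd.comp Computable.snd)
  · induction d a with
    | zero => simp
    | succ n ih =>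
      simp only at ih ⊢
      rw [ih, Finset.range_add_one, Finset.sup_insert]

theorem computablePred_lt (hf : Computable f) (hg : Computable g) :
    ComputablePred fun a => f a < g a := by
  have h := (Primrec.nat_lt.decide.to_comp.comp hf hg)
  exact h.computablePred

theorem computablePred_and {p q : α → Prop} (hp : ComputablePred p) (hq : ComputablePred q) :
    ComputablePred fun a => p a ∧ q a := by
  classical
  refine (Computable.cond hp.decide hq.decide (Computable.const false)).of_eq
    (g := fun a => decide (p a ∧ q a)) (fun a => ?_) |>.computablePred
  by_cases h : p a <;> simp [h]

theorem computablePred_comp {β : Type*} [Primcodable β] {p : α → Prop} (hp : ComputablePred p)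
    {h : β → α} (hh : Computable h) : ComputablePred fun b => p (h b) := by
  classical
  exact (hp.decide.comp hh).computablePred

end Arithmetic

/-! ### Rational codes and computable sequences of reals. -/

theorem ratOf_pair (p q r : ℕ) :
    ratOf (Nat.pair (Nat.pair p q) r) = ((p : ℚ) - q) / ((r : ℚ) + 1) := by
  simp [ratOf]

theorem ratOf_surjective : Function.Surjective ratOf := by
  intro x
  refine ⟨Nat.pair (Nat.pair x.num.toNat (-x.num).toNat) (x.den - 1), ?_⟩
  rw [ratOf_pair]
  have h1 : ((x.num.toNat : ℚ) - ((-x.num).toNat : ℚ)) = x.num := by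
    have : ((x.num.toNat : ℤ) - ((-x.num).toNat : ℤ)) = x.num := by omega
    exact_mod_cast this
  have h2 : (((x.den - 1 : ℕ) : ℚ) + 1) = x.den := by
    have : x.den - 1 + 1 = x.den := Nat.sub_add_cancel x.pos
    exact_mod_cast this
  rw [h1, h2, Rat.num_div_den]

@[simp] theorem ratOf_zero : ratOf 0 = 0 := by
  simp [ratOf]

theorem abs_natDiv_sub_natDiv_sub_le (p q k : ℕ) (hk : k ≠ 0) :
    |((p / k : ℕ) : ℝ) - ((q / k : ℕ) : ℝ) - ((p : ℝ) - q) / k| ≤ 1 := by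
  have hk' : (0 : ℝ) < k := by positivity
  have h1 := Nat.cast_div_le (α := ℝ) (m := p) (n := k)
  have h2 := Nat.cast_div_le (α := ℝ) (m := q) (n := k)
  have h3 : (p : ℝ) / k < ((p / k : ℕ) : ℝ) + 1 := by
    rw [← Nat.floor_div_eq_div (K := ℝ)]; exact Nat.lt_floor_add_one _
  have h4 : (q : ℝ) / k < ((q / k : ℕ) : ℝ) + 1 := by
    rw [← Nat.floor_div_eq_div (K := ℝ)]; exact Nat.lt_floor_add_one _
  rw [sub_div, abs_le]
  constructor <;> linarith

theorem sqrt_add_le_sqrt_add_sqrt {a b : ℝ} (ha : 0 ≤ a) (hb : 0 ≤ b) : √(a + b) ≤ √a + √b := by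
  rw [Real.sqrt_le_left (by positivity)]
  nlinarith [Real.sq_sqrt ha, Real.sq_sqrt hb, mul_nonneg (Real.sqrt_nonneg a) (Real.sqrt_nonneg b)]

/-- A sequence of reals is computable if its integer multiples are approximated by integers,
recursively and up to an error that does not depend on the multiplier. -/
theorem IsComputableRealSeq.of_scaled {x : ℕ → ℝ} {p q : ℕ → ℕ → ℕ} {C : ℕ → ℕ}
    (hp : Computable₂ p) (hq : Computable₂ q) (hC : Computable C)
    (h : ∀ n k : ℕ, k ≠ 0 → |(k : ℝ) * x n - ((p n k : ℝ) - q n k)| ≤ C n) :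
    IsComputableRealSeq x := by
  have hK : Computable fun a : ℕ × ℕ => 2 ^ a.2 * (C a.1 + 1) :=
    computable_mul (computable_two_pow Computable.snd)
      (Computable.succ.comp (hC.comp Computable.fst))
  -- The multiplier `K = 2 ^ k * (C n + 1)` makes the error `C n / K` less than `2⁻¹ ^ k`. The code
  -- stores `K - 1` because `ratOf` adds one to the denominator.
  refine ⟨fun n k => Nat.pair (Nat.pair (p n (2 ^ k * (C n + 1))) (q n (2 ^ k * (C n + 1))))
    (2 ^ k * (C n + 1) - 1), ?_, fun n k => ?_⟩
  · exact computable_pair (computable_pair (hp.comp Computable.fst hK) (hq.comp Computable.fst hK))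
      (computable_sub hK (Computable.const 1))
  · have hpos : 0 < 2 ^ k * (C n + 1) := by positivity
    have h' := h n (2 ^ k * (C n + 1)) hpos.ne'
    set K := 2 ^ k * (C n + 1) with hKdef
    have hKr : (K : ℝ) = 2 ^ k * ((C n : ℝ) + 1) := by rw [hKdef]; push_cast; ring
    have hK1 : (((K - 1 : ℕ) : ℝ) + 1) = K := by
      have : K - 1 + 1 = K := Nat.sub_add_cancel hpos
      exact_mod_cast this
    have hKp : (0 : ℝ) < K := by exact_mod_cast hpos
    rw [ratOf_pair]
    push_cast
    rw [hK1]
    have e : x n - ((p n K : ℝ) - q n K) / K = (K * x n - ((p n K : ℝ) - q n K)) / K := by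
      field_simp
    rw [e, abs_div, abs_of_pos hKp, div_lt_iff₀ hKp]
    refine h'.trans_lt ?_
    rw [hKr]
    have : (2⁻¹ : ℝ) ^ k * (2 ^ k * ((C n : ℝ) + 1)) = C n + 1 := by
      rw [← mul_assoc, ← mul_pow]; norm_num
    rw [this]
    linarith

/-- Converse of `of_scaled`: the `k`-th approximation is precise enough for the multiplier `k`,
since `k * 2⁻¹ ^ k ≤ 1`, and the two floor divisions cost at most one more. Closure properties
thereby reduce to arithmetic of natural numbers. -/
theorem IsComputableRealSeq.scaled {x : ℕ → ℝ} (hx : IsComputableRealSeq x) :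
    ∃ p q : ℕ → ℕ → ℕ, Computable₂ p ∧ Computable₂ q ∧
      ∀ n k : ℕ, k ≠ 0 → |(k : ℝ) * x n - ((p n k : ℝ) - q n k)| ≤ 2 := by
  obtain ⟨r, hr, h⟩ := hx
  have h1 := computable_unpair_fst (computable_unpair_fst hr)
  have h2 := computable_unpair_snd (computable_unpair_fst hr)
  have h3 := Computable.succ.comp (computable_unpair_snd hr)
  have hk : Computable fun a : ℕ × ℕ => a.2 := Computable.snd
  refine ⟨fun n k => k * (r n k).unpair.1.unpair.1 / ((r n k).unpair.2 + 1),
    fun n k => k * (r n k).unpair.1.unpair.2 / ((r n k).unpair.2 + 1),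
    computable_div (computable_mul hk h1) h3, computable_div (computable_mul hk h2) h3,
    fun n k hk => ?_⟩
  have h' := h n k
  simp only [ratOf] at h'
  set P := (r n k).unpair.1.unpair.1
  set Q := (r n k).unpair.1.unpair.2
  set R := (r n k).unpair.2
  have e := abs_natDiv_sub_natDiv_sub_le (k * P) (k * Q) (R + 1) (by omega)
  push_cast at e h'
  have hk' : (0 : ℝ) < k := by positivity
  have hb : (k : ℝ) * (2⁻¹ : ℝ) ^ k ≤ 1 := by
    rw [inv_pow, ← div_eq_mul_inv, div_le_one (by positivity)]
    exact_mod_cast Nat.lt_two_pow_self.le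
  have h'' : |(k : ℝ) * x n - (k * P - k * Q) / (R + 1)| ≤ 1 := by
    have : (k : ℝ) * x n - (k * P - k * Q) / (R + 1) = k * (x n - (P - Q) / (R + 1)) := by ring
    rw [this, abs_mul, abs_of_pos hk']
    exact (mul_le_mul_of_nonneg_left h'.le hk'.le).trans hb
  rw [abs_le] at *
  constructor <;> linarith [e.1, e.2, h''.1, h''.2]

namespace IsComputableRealSeq

variable {x y : ℕ → ℝ}

theorem ratOf_comp {g : ℕ → ℕ} (hg : Computable g) :
    IsComputableRealSeq fun n => (ratOf (g n) : ℝ) :=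
  ⟨fun n _ => g n, hg.comp Computable.fst, fun n k => by simp⟩

theorem natCast {g : ℕ → ℕ} (hg : Computable g) : IsComputableRealSeq fun n => (g n : ℝ) := by
  have := ratOf_comp (computable_pair (computable_pair hg (Computable.const 0))
    (Computable.const 0))
  simpa [ratOf_pair] using this

theorem comp (hx : IsComputableRealSeq x) {g : ℕ → ℕ} (hg : Computable g) :
    IsComputableRealSeq fun n => x (g n) := by
  obtain ⟨r, hr, h⟩ := hx
  exact ⟨fun n k => r (g n) k, hr.comp (hg.comp Computable.fst) Computable.snd, fun n k => h _ _⟩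

theorem exists_bound (hx : IsComputableRealSeq x) :
    ∃ B : ℕ → ℕ, Computable B ∧ ∀ n, |x n| ≤ B n := by
  obtain ⟨p, q, hp, hq, h⟩ := hx.scaled
  refine ⟨fun n => p n 1 + q n 1 + 2, computable_add (computable_add
    (hp.comp Computable.id (Computable.const 1)) (hq.comp Computable.id (Computable.const 1)))
    (Computable.const 2), fun n => ?_⟩
  have := h n 1 one_ne_zero
  have hp0 : (0 : ℝ) ≤ p n 1 := by positivity
  have hq0 : (0 : ℝ) ≤ q n 1 := by positivity
  push_cast at this ⊢
  rw [abs_le] at *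
  constructor <;> linarith [this.1, this.2]

theorem add (hx : IsComputableRealSeq x) (hy : IsComputableRealSeq y) :
    IsComputableRealSeq fun n => x n + y n := by
  obtain ⟨p, q, hp, hq, h⟩ := hx.scaled
  obtain ⟨p', q', hp', hq', h'⟩ := hy.scaled
  refine of_scaled (p := fun n k => p n k + p' n k) (q := fun n k => q n k + q' n k)
    (C := fun _ => 4) (computable_add hp hp') (computable_add hq hq') (Computable.const 4)
    fun n k hk => ?_
  have a := h n k hk
  have b := h' n k hk
  push_cast
  rw [abs_le] at *
  constructor <;> linarith [a.1, a.2, b.1, b.2]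

theorem neg (hx : IsComputableRealSeq x) : IsComputableRealSeq fun n => -x n := by
  obtain ⟨p, q, hp, hq, h⟩ := hx.scaled
  refine of_scaled (C := fun _ => 2) hq hp (Computable.const 2) fun n k hk => ?_
  have a := h n k hk
  push_cast
  rw [abs_le] at *
  constructor <;> linarith [a.1, a.2]

theorem mul (hx : IsComputableRealSeq x) (hy : IsComputableRealSeq y) :
    IsComputableRealSeq fun n => x n * y n := by
  obtain ⟨p, q, hp, hq, h⟩ := hx.scaled
  obtain ⟨p', q', hp', hq', h'⟩ := hy.scaled
  obtain ⟨B, hB, hb⟩ := hx.exists_bound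
  obtain ⟨B', hB', hb'⟩ := hy.exists_bound
  -- These are the positive and negative parts of `(p - q) * (p' - q')`, divided by `k` because the
  -- product of two `k`-fold multiples carries the factor `k ^ 2`. In the error bound, `B` and `B'`
  -- weight the errors of the other factor, 4 covers the product of the two errors, and 1 the floor
  -- divisions.
  refine of_scaled
    (p := fun n k => (p n k * p' n k + q n k * q' n k) / k)
    (q := fun n k => (p n k * q' n k + q n k * p' n k) / k)
    (C := fun n => 2 * B n + 2 * B' n + 4 + 1)
    (computable_div (computable_add (computable_mul hp hp') (computable_mul hq hq'))
      Computable.snd)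
    (computable_div (computable_add (computable_mul hp hq') (computable_mul hq hp'))
      Computable.snd)
    (computable_add (computable_add (computable_add (computable_mul (Computable.const 2) hB)
      (computable_mul (Computable.const 2) hB')) (Computable.const 4)) (Computable.const 1))
    fun n k hk => ?_
  have a := h n k hk
  have b := h' n k hk
  have e := abs_natDiv_sub_natDiv_sub_le (p n k * p' n k + q n k * q' n k) (p n k * q' n k + q n k * p' n k)
    k hk
  have hk1 : (1 : ℝ) ≤ k := by exact_mod_cast Nat.one_le_iff_ne_zero.2 hk
  have hk0 : (0 : ℝ) < k := by linarith
  push_cast at e ⊢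
  set P := (p n k : ℝ) - q n k with hP
  set Q := (p' n k : ℝ) - q' n k with hQ
  have e1 : ((p n k : ℝ) * p' n k + q n k * q' n k - (p n k * q' n k + q n k * p' n k)) = P * Q := by
    rw [hP, hQ]; ring
  rw [e1] at e
  have key : |(k : ℝ) * (x n * y n) - P * Q / k| ≤ 2 * B n + 2 * B' n + 4 := by
    have e2 : (k : ℝ) * (x n * y n) - P * Q / k
        = (k * x n * (k * y n - Q) + (k * x n - P) * (k * y n)
          - (k * x n - P) * (k * y n - Q)) / k := by
      field_simp; ring
    rw [e2, abs_div, abs_of_pos hk0, div_le_iff₀ hk0]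
    have t1 : |k * x n * (k * y n - Q)| ≤ k * B n * 2 := by
      rw [abs_mul, abs_mul, abs_of_pos hk0]
      have := hb n
      gcongr
    have t2 : |(k * x n - P) * (k * y n)| ≤ 2 * (k * B' n) := by
      rw [abs_mul, abs_mul, abs_of_pos hk0]
      have := hb' n
      gcongr
    have t3 : |(k * x n - P) * (k * y n - Q)| ≤ 2 * 2 := by
      rw [abs_mul]
      gcongr
    have t4 := abs_sub (k * x n * (k * y n - Q) + (k * x n - P) * (k * y n))
      ((k * x n - P) * (k * y n - Q))
    have t5 := abs_add_le (k * x n * (k * y n - Q)) ((k * x n - P) * (k * y n))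
    nlinarith
  rw [abs_le] at *
  constructor <;> linarith [e.1, e.2, key.1, key.2]

theorem sqrt (hx : IsComputableRealSeq x) (h0 : ∀ n, 0 ≤ x n) :
    IsComputableRealSeq fun n => √(x n) := by
  obtain ⟨p, q, hp, hq, h⟩ := hx.scaled
  have hk : Computable fun a : ℕ × ℕ => a.2 * a.2 := computable_mul Computable.snd Computable.snd
  -- Since `k * √x = √(k ^ 2 * x)`, the multiplier `k * k` is used under the root. An error of 2
  -- there becomes at most `√2 ≤ 2`, and the integer root adds 1. Truncated subtraction does no harm
  -- because `x` is nonnegative.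
  refine of_scaled (p := fun n k => Nat.sqrt (p n (k * k) - q n (k * k))) (q := fun _ _ => 0)
    (C := fun _ => 3)
    (Primrec.nat_sqrt.to_comp.comp (computable_sub (hp.comp Computable.fst hk)
      (hq.comp Computable.fst hk)))
    (Computable.const 0) (Computable.const 3) fun n k hk => ?_
  have a := h n (k * k) (by positivity)
  set m := p n (k * k) - q n (k * k) with hm
  have ha : |(k : ℝ) * k * x n - m| ≤ 2 := by
    push_cast at a
    have h0' : 0 ≤ (k : ℝ) * k * x n := by have := h0 n; positivity
    rcases le_total (p n (k * k)) (q n (k * k)) with hle | hle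
    · rw [hm, Nat.sub_eq_zero_of_le hle, Nat.cast_zero, sub_zero, abs_of_nonneg h0']
      have : (p n (k * k) : ℝ) ≤ q n (k * k) := by exact_mod_cast hle
      have := (abs_le.1 a).2
      linarith
    · rw [hm, Nat.cast_sub hle]
      exact a
  have e : (k : ℝ) * √(x n) = √((k : ℝ) * k * x n) := by
    rw [Real.sqrt_mul (by positivity), Real.sqrt_mul_self (by positivity)]
  rw [e]
  have s1 : ((Nat.sqrt m : ℕ) : ℝ) ≤ √(m : ℝ) := Real.nat_sqrt_le_real_sqrt
  have s2 : √(m : ℝ) ≤ (Nat.sqrt m : ℕ) + 1 := Real.real_sqrt_le_nat_sqrt_succ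
  have h2 : √(2 : ℝ) ≤ 2 := by
    rw [Real.sqrt_le_left (by norm_num)]; norm_num
  obtain ⟨a1, a2⟩ := abs_le.1 ha
  have u1 : √((k : ℝ) * k * x n) ≤ √(m : ℝ) + √2 := by
    refine (Real.sqrt_le_sqrt (by linarith : (k : ℝ) * k * x n ≤ m + 2)).trans ?_
    exact sqrt_add_le_sqrt_add_sqrt (by positivity) (by norm_num)
  have u2 : √(m : ℝ) ≤ √((k : ℝ) * k * x n) + √2 := by
    refine (Real.sqrt_le_sqrt (by linarith : (m : ℝ) ≤ (k : ℝ) * k * x n + 2)).trans ?_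
    exact sqrt_add_le_sqrt_add_sqrt (by have := h0 n; positivity) (by norm_num)
  push_cast
  rw [abs_le]
  constructor <;> linarith

theorem sum {x : ℕ → ℕ → ℝ} (hx : IsComputableRealSeq fun m => x m.unpair.1 m.unpair.2)
    {d : ℕ → ℕ} (hd : Computable d) :
    IsComputableRealSeq fun n => ∑ i ∈ Finset.range (d n), x n i := by
  obtain ⟨p, q, hp, hq, h⟩ := hx.scaled
  have hn : Computable fun a : (ℕ × ℕ) × ℕ => Nat.pair a.1.1 a.2 :=
    computable_pair (Computable.fst.comp Computable.fst) Computable.snd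
  have hk : Computable fun a : (ℕ × ℕ) × ℕ => a.1.2 := Computable.snd.comp Computable.fst
  have hd' : Computable fun a : ℕ × ℕ => d a.1 := hd.comp Computable.fst
  refine of_scaled (p := fun n k => ∑ i ∈ Finset.range (d n), p (Nat.pair n i) k)
    (q := fun n k => ∑ i ∈ Finset.range (d n), q (Nat.pair n i) k)
    (C := fun n => d n * 2) (computable_sum hd' (hp.comp hn hk)) (computable_sum hd' (hq.comp hn hk))
    (computable_mul hd (Computable.const 2)) fun n k hk => ?_
  push_cast
  rw [Finset.mul_sum, ← Finset.sum_sub_distrib, ← Finset.sum_sub_distrib]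
  refine (Finset.abs_sum_le_sum_abs _ _).trans ?_
  refine (Finset.sum_le_card_nsmul _ _ 2 fun i _ => ?_).trans (by simp)
  simpa using h (Nat.pair n i) k hk

/-- The limit of a computable double sequence that converges effectively. -/
theorem lim {x : ℕ → ℕ → ℝ} (hx : IsComputableRealSeq fun m => x m.unpair.1 m.unpair.2)
    {g : ℕ → ℕ → ℕ} (hg : Computable₂ g)
    (h : ∀ n N, |x n (g n N) - y n| ≤ (2⁻¹ : ℝ) ^ N) : IsComputableRealSeq y := by
  obtain ⟨r, hr, hr'⟩ := hx
  have hk : Computable fun a : ℕ × ℕ => a.2 + 1 := Computable.succ.comp Computable.snd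
  refine ⟨fun n k => r (Nat.pair n (g n (k + 1))) (k + 1),
    hr.comp (computable_pair Computable.fst (hg.comp Computable.fst hk)) hk, fun n k => ?_⟩
  have h1 := hr' (Nat.pair n (g n (k + 1))) (k + 1)
  have h2 := h n (k + 1)
  simp only [Nat.unpair_pair] at h1
  have e : (2⁻¹ : ℝ) ^ k = 2⁻¹ ^ (k + 1) + 2⁻¹ ^ (k + 1) := by rw [pow_succ]; ring
  rw [e]
  rw [abs_lt] at *
  rw [abs_le] at h2
  constructor <;> linarith [h1.1, h1.2, h2.1, h2.2]

/-- Smallness of the terms of a computable sequence is decidable up to a gap. -/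
theorem exists_gap_test (hx : IsComputableRealSeq x) :
    ∃ P : ℕ → ℕ → Prop, ComputablePred (fun a : ℕ × ℕ => P a.1 a.2) ∧
      ∀ n k, (P n k → x n < (2⁻¹ : ℝ) ^ k) ∧ (x n < (2⁻¹ : ℝ) ^ (k + 1) → P n k) := by
  obtain ⟨r, hr, h⟩ := hx
  have hk : Computable fun a : ℕ × ℕ => a.2 + 2 :=
    computable_add Computable.snd (Computable.const 2)
  have hr := hr.comp (Computable.fst (α := ℕ) (β := ℕ)) hk
  -- With `η = 2⁻¹ ^ (k + 2)`, the test asks whether an approximation with error below `η` is less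
  -- than `3 * η`, halfway between the thresholds `2 * η` and `4 * η`. Denominators and subtractions
  -- are cleared to stay in the natural numbers.
  refine ⟨fun n k => 2 ^ (k + 2) * (r n (k + 2)).unpair.1.unpair.1 <
    3 * ((r n (k + 2)).unpair.2 + 1) + 2 ^ (k + 2) * (r n (k + 2)).unpair.1.unpair.2, ?_,
    fun n k => ?_⟩
  · refine computablePred_lt
      (computable_mul (computable_two_pow hk) (computable_unpair_fst (computable_unpair_fst hr)))
      (computable_add (computable_mul (Computable.const 3)
        (Computable.succ.comp (computable_unpair_snd hr)))
        (computable_mul (computable_two_pow hk) (computable_unpair_snd (computable_unpair_fst hr))))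
  · have h' := h n (k + 2)
    simp only [ratOf] at h'
    set P := (r n (k + 2)).unpair.1.unpair.1
    set Q := (r n (k + 2)).unpair.1.unpair.2
    set R := (r n (k + 2)).unpair.2
    push_cast at h'
    have hR : (0 : ℝ) < R + 1 := by positivity
    have e1 : (2⁻¹ : ℝ) ^ (k + 1) = 2 * 2⁻¹ ^ (k + 2) := by rw [pow_succ _ (k + 1)]; ring
    have e0 : (2⁻¹ : ℝ) ^ k = 4 * 2⁻¹ ^ (k + 2) := by rw [pow_add]; ring
    have e2 : (2 : ℝ) ^ (k + 2) * 2⁻¹ ^ (k + 2) = 1 := by rw [← mul_pow]; norm_num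
    have key : 2 ^ (k + 2) * P < 3 * (R + 1) + 2 ^ (k + 2) * Q ↔
        ((P : ℝ) - Q) / (R + 1) < 3 * 2⁻¹ ^ (k + 2) := by
      rw [div_lt_iff₀ hR, ← Nat.cast_lt (α := ℝ),
        ← mul_lt_mul_iff_right₀ (by positivity : (0 : ℝ) < 2 ^ (k + 2)) (b := (P : ℝ) - Q)]
      have : (2 : ℝ) ^ (k + 2) * (3 * 2⁻¹ ^ (k + 2) * (R + 1)) = 3 * (R + 1) := by
        linear_combination (3 * ((R : ℝ) + 1)) * e2
      rw [this]
      push_cast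
      constructor <;> intro h <;> linarith
    change (2 ^ (k + 2) * P < 3 * (R + 1) + 2 ^ (k + 2) * Q → _) ∧
      (_ → 2 ^ (k + 2) * P < 3 * (R + 1) + 2 ^ (k + 2) * Q)
    rw [key, e1, e0]
    rw [abs_lt] at h'
    constructor <;> intro h <;> linarith [h'.1, h'.2]

end IsComputableRealSeq

/-! ### Computable scalars, real and complex at once. -/

section Scalars

variable {𝕜 : Type*} [RCLike 𝕜]

/-- The value is 0 in the real case and 1 in the complex case. As a natural number it is a
computable constant, so the imaginary parts of `scalarOf` need no case distinction. -/
theorem im_I_eq_natCast (𝕜 : Type*) [RCLike 𝕜] : ∃ t : ℕ, RCLike.im (RCLike.I : 𝕜) = t := by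
  rcases RCLike.I_mul_I (K := 𝕜) with h | h
  · exact ⟨0, by simp [h]⟩
  · refine ⟨1, ?_⟩
    have h1 : RCLike.re ((RCLike.I : 𝕜) * RCLike.I) = -1 := by rw [h]; simp
    have h2 := RCLike.I_im (RCLike.I : 𝕜)
    have h0 : RCLike.im (RCLike.I : 𝕜) ≠ 0 := by
      intro h0
      simp [RCLike.mul_re, h0] at h1
    have h3 : RCLike.im (RCLike.I : 𝕜) * RCLike.im (RCLike.I : 𝕜) = 1 := by
      simp [RCLike.mul_re] at h1
      linarith
    rcases mul_self_eq_one_iff.1 h3 with h4 | h4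
    · simpa using h4
    · rw [h4] at h2
      simp at h2
      linarith

theorem scalarOf_re (n : ℕ) : RCLike.re (scalarOf 𝕜 n) = (ratOf n.unpair.1 : ℝ) := by
  have h : ∀ q : ℚ, (q : 𝕜) = ((q : ℝ) : 𝕜) := fun q => by simp
  rw [scalarOf, h, h, map_add, RCLike.re_ofReal_mul, RCLike.ofReal_re, RCLike.I_re]
  simp

theorem scalarOf_im (n : ℕ) :
    RCLike.im (scalarOf 𝕜 n) = (ratOf n.unpair.2 : ℝ) * RCLike.im (RCLike.I : 𝕜) := by
  have h : ∀ q : ℚ, (q : 𝕜) = ((q : ℝ) : 𝕜) := fun q => by simp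
  rw [scalarOf, h, h, map_add, RCLike.im_ofReal_mul, RCLike.ofReal_im, zero_add]

@[simp] theorem scalarOf_zero : scalarOf 𝕜 0 = 0 := by
  simp [scalarOf]

theorem denseRange_scalarOf (𝕜 : Type*) [RCLike 𝕜] : DenseRange (scalarOf 𝕜) := by
  have hr : DenseRange fun n => (ratOf n : ℝ) :=
    (Rat.denseRange_cast (𝕜 := ℝ)).comp ratOf_surjective.denseRange Rat.continuous_coe_real
  have h2 := (hr.prodMap hr)
  let F : ℝ × ℝ → 𝕜 := fun p => (p.1 : 𝕜) + (p.2 : 𝕜) * RCLike.I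
  have hF : Continuous F := by fun_prop
  have hs : Function.Surjective F := fun z => ⟨(RCLike.re z, RCLike.im z), RCLike.re_add_im z⟩
  have h3 := hs.denseRange.comp h2 hF
  refine Dense.mono ?_ h3
  rintro _ ⟨⟨p, q⟩, rfl⟩
  exact ⟨Nat.pair p q, by simp [scalarOf, F]⟩

namespace IsComputableScalarSeq

theorem scalarOf_comp {g : ℕ → ℕ} (hg : Computable g) :
    IsComputableScalarSeq fun n => scalarOf 𝕜 (g n) := by
  obtain ⟨t, ht⟩ := im_I_eq_natCast 𝕜
  constructor
  · simp only [scalarOf_re]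
    exact .ratOf_comp (computable_unpair_fst hg)
  · simp only [scalarOf_im, ht]
    exact (IsComputableRealSeq.ratOf_comp (computable_unpair_snd hg)).mul
      (.natCast (Computable.const t))

theorem natCast {g : ℕ → ℕ} (hg : Computable g) : IsComputableScalarSeq fun n => (g n : 𝕜) := by
  constructor
  · simpa using IsComputableRealSeq.natCast hg
  · simpa using IsComputableRealSeq.natCast (Computable.const 0)

variable {x y : ℕ → 𝕜}

theorem add (hx : IsComputableScalarSeq x) (hy : IsComputableScalarSeq y) :
    IsComputableScalarSeq fun n => x n + y n :=
  ⟨by simpa using hx.1.add hy.1, by simpa using hx.2.add hy.2⟩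

theorem neg (hx : IsComputableScalarSeq x) : IsComputableScalarSeq fun n => -x n :=
  ⟨by simpa using hx.1.neg, by simpa using hx.2.neg⟩

theorem mul (hx : IsComputableScalarSeq x) (hy : IsComputableScalarSeq y) :
    IsComputableScalarSeq fun n => x n * y n :=
  ⟨by simpa [sub_eq_add_neg] using (hx.1.mul hy.1).add (hx.2.mul hy.2).neg,
    by simpa using (hx.1.mul hy.2).add (hx.2.mul hy.1)⟩

theorem comp (hx : IsComputableScalarSeq x) {g : ℕ → ℕ} (hg : Computable g) :
    IsComputableScalarSeq fun n => x (g n) :=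
  ⟨hx.1.comp hg, hx.2.comp hg⟩

theorem norm (hx : IsComputableScalarSeq x) : IsComputableRealSeq fun n => ‖x n‖ := by
  have h := ((hx.1.mul hx.1).add (hx.2.mul hx.2)).sqrt
    fun n => add_nonneg (mul_self_nonneg _) (mul_self_nonneg _)
  simpa only [← RCLike.normSq_apply, RCLike.sqrt_normSq_eq_norm] using h

theorem sum {x : ℕ → ℕ → 𝕜} (hx : IsComputableScalarSeq₂ x) {d : ℕ → ℕ} (hd : Computable d) :
    IsComputableScalarSeq fun n => ∑ i ∈ Finset.range (d n), x n i := by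
  constructor
  · simpa only [map_sum] using hx.1.sum (x := fun n i => RCLike.re (x n i)) hd
  · simpa only [map_sum] using hx.2.sum (x := fun n i => RCLike.im (x n i)) hd

end IsComputableScalarSeq

theorem computable_ite_eq {α : Type*} [Primcodable α] {f g : α → ℕ} (hf : Computable f)
    (hg : Computable g) : Computable fun a => if f a = g a then 1 else 0 := by
  have h : Primrec fun p : ℕ × ℕ => if p.1 = p.2 then 1 else 0 :=
    Primrec.ite (Primrec.eq.comp Primrec.fst Primrec.snd) (Primrec.const 1) (Primrec.const 0)
  exact h.to_comp.comp (hf.pair hg)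

theorem IsComputableScalar.diagonal {c : 𝕜} (hc : IsComputableScalar c) :
    IsComputableScalarSeq₂ fun n k => if k = n then c else 0 := by
  have h := (IsComputableScalarSeq.natCast (𝕜 := 𝕜) (computable_ite_eq
    (computable_unpair_snd Computable.id) (computable_unpair_fst Computable.id))).mul hc
  simpa [IsComputableScalarSeq₂] using h

theorem IsComputableScalar.natCast (n : ℕ) : IsComputableScalar (n : 𝕜) :=
  IsComputableScalarSeq.natCast (Computable.const n)

theorem IsComputableScalar.zero : IsComputableScalar (0 : 𝕜) := by
  simpa using IsComputableScalar.natCast (𝕜 := 𝕜) 0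

theorem IsComputableScalar.one : IsComputableScalar (1 : 𝕜) := by
  simpa using IsComputableScalar.natCast (𝕜 := 𝕜) 1

theorem IsComputableScalar.neg_one : IsComputableScalar (-1 : 𝕜) :=
  IsComputableScalarSeq.neg (x := fun _ => (1 : 𝕜)) IsComputableScalar.one

theorem IsComputableScalarSeq₂.zero : IsComputableScalarSeq₂ fun _ _ => (0 : 𝕜) :=
  IsComputableScalar.zero

end Scalars

/-! ### Computability structures, names and indices. -/

section Space

variable {𝕜 X : Type*} [RCLike 𝕜] [NormedAddCommGroup X] [NormedSpace 𝕜 X]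

namespace ComputabilityStructure

variable {S : ComputabilityStructure 𝕜 X} {e : ℕ → X}

/-- Diagonal coefficients reduce the sum in the linear forms axiom to its last term. -/
theorem smul_add_smul_mem {x y : ℕ → X} (hx : x ∈ S.seqs) (hy : y ∈ S.seqs) {c d : 𝕜}
    (hc : IsComputableScalar c) (hd : IsComputableScalar d) :
    (fun n => c • x n + d • y n) ∈ S.seqs := by
  have h := S.linear_mem x hx y hy _ _ hc.diagonal hd.diagonal id Computable.id
  convert h using 2 with n
  rw [Finset.sum_add_distrib]
  simp [ite_smul]

theorem sub_mem {x y : ℕ → X} (hx : x ∈ S.seqs) (hy : y ∈ S.seqs) :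
    (fun n => x n - y n) ∈ S.seqs := by
  simpa [sub_eq_add_neg] using smul_add_smul_mem hx hy IsComputableScalar.one IsComputableScalar.neg_one

theorem ratSpan_comp_mem (he : e ∈ S.seqs) {g : ℕ → ℕ} (hg : Computable g) :
    (fun n => ratSpan 𝕜 e (g n)) ∈ S.seqs := by
  have hl : Computable fun n => Denumerable.ofNat (List ℕ) (g n) :=
    (Computable.ofNat (List ℕ)).comp hg
  have hget : Computable fun m : ℕ =>
      (Denumerable.ofNat (List ℕ) (g m.unpair.1)).getD m.unpair.2 0 :=
    (Primrec.list_getD 0).to_comp.comp (hl.comp (computable_unpair_fst Computable.id))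
      (computable_unpair_snd Computable.id)
  have ha : IsComputableScalarSeq₂ fun n k =>
      scalarOf 𝕜 ((Denumerable.ofNat (List ℕ) (g n)).getD k 0) :=
    IsComputableScalarSeq.scalarOf_comp hget
  -- The axiom sums one term beyond the length of the list. The default entry 0 codes the scalar 0,
  -- so this term vanishes.
  have h := S.linear_mem e he e he _ _ ha .zero
    (fun n => (Denumerable.ofNat (List ℕ) (g n)).length) (Computable.list_length.comp hl)
  convert h using 2 with n
  rw [ratSpan, Finset.sum_range_succ]
  simp

theorem IsGenerating.denseRange_ratSpan (he : S.IsGenerating e) : DenseRange (ratSpan 𝕜 e) := by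
  have h := he.2
  refine (h.mono ?_).of_closure
  intro x hx
  obtain ⟨c, rfl⟩ := (Finsupp.mem_span_range_iff_exists_finsupp).1 hx
  obtain ⟨N, hN⟩ : ∃ N, c.support ⊆ Finset.range N :=
    ⟨c.support.sup id + 1, fun i hi => Finset.mem_range.2
      (Nat.lt_succ_of_le (Finset.le_sup (f := id) hi))⟩
  have hsum : (c.sum fun i a => a • e i) = ∑ i ∈ Finset.range N, c i • e i :=
    Finsupp.sum_of_support_subset c hN _ (by simp)
  rw [hsum]
  have hq : ∀ i, ∃ q : ℕ → ℕ, Tendsto (fun n => scalarOf 𝕜 (q n)) atTop (𝓝 (c i)) := by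
    intro i
    obtain ⟨u, hu, hu'⟩ := mem_closure_iff_seq_limit.1 (denseRange_scalarOf 𝕜 (c i))
    choose q hq using hu
    exact ⟨q, by simpa [hq] using hu'⟩
  choose q hq using hq
  refine mem_closure_of_tendsto (tendsto_finsetSum _ fun i _ => (hq i).smul_const (e i))
    (Eventually.of_forall fun n => ?_)
  refine ⟨Encodable.encode ((List.range N).map fun i => q i n), ?_⟩
  rw [ratSpan, Denumerable.ofNat_encode, List.length_map, List.length_range]
  refine Finset.sum_congr rfl fun i hi => ?_
  rw [Finset.mem_range] at hi
  simp [List.getD, hi]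

end ComputabilityStructure

/-- `b` is a fast Cauchy name of `x`: a computable sequence of codes of rational linear
combinations that converges to `x` with the standard rate. -/
def IsName (𝕜 : Type*) {X : Type*} [RCLike 𝕜] [NormedAddCommGroup X] [NormedSpace 𝕜 X]
    (e : ℕ → X) (b : ℕ → ℕ) (x : X) : Prop :=
  ∀ k, ‖ratSpan 𝕜 e (b k) - x‖ < (2⁻¹ : ℝ) ^ k

variable {S : ComputabilityStructure 𝕜 X} {e : ℕ → X}

theorem partrec₂_phi : Partrec₂ phi :=
  Nat.Partrec.Code.eval_part.comp ((Computable.ofNat Nat.Partrec.Code).comp Computable.fst)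
    Computable.snd

theorem IsIndex.exists_isName {n : ℕ} {x : X} (h : IsIndex 𝕜 e n x) :
    ∃ b, Computable b ∧ IsName 𝕜 e b x ∧ ∀ k, b k ∈ phi n k := by
  choose b hb hx using h
  have h1 : Partrec fun k => phi n k := partrec₂_phi.comp (Computable.const n) Computable.id
  exact ⟨b, h1.of_eq_tot hb, hx, hb⟩

/-- A uniform family of names has a uniform family of indices. -/
theorem exists_index_of_isName {α : Type*} [Primcodable α] {σ : α → ℕ → ℕ} (hσ : Computable₂ σ) :
    ∃ s : α → ℕ, Computable s ∧ ∀ a x, IsName 𝕜 e (σ a) x → IsIndex 𝕜 e (s a) x := by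
  have h : Nat.Partrec _ := Computable₂.partrec₂ hσ
  obtain ⟨c, hc⟩ := Nat.Partrec.Code.exists_code.1 h
  -- The s-m-n theorem: `a` is built into the program as its first argument.
  refine ⟨fun a => Encodable.encode (c.curry (Encodable.encode a)),
    Computable.encode.comp (Nat.Partrec.Code.primrec₂_curry.to_comp.comp (Computable.const c)
      Computable.encode), fun a x hx k => ⟨σ a k, ?_, hx k⟩⟩
  rw [phi, Denumerable.ofNat_encode, Nat.Partrec.Code.eval_curry, hc]
  simp

theorem IsName.mem_elements (he : e ∈ S.seqs) {b : ℕ → ℕ} (hb : Computable b) {x : X}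
    (h : IsName 𝕜 e b x) : x ∈ S.elements := by
  refine S.limit_mem (fun _ k => ratSpan 𝕜 e (b k)) (fun _ => x)
    (ComputabilityStructure.ratSpan_comp_mem he (hb.comp (computable_unpair_snd Computable.id)))
    ⟨fun _ N => N, Computable.snd, fun n N k hk => (h k).le.trans ?_⟩
  exact pow_le_pow_of_le_one (by norm_num) (by norm_num) hk

theorem IsIndex.mem_elements (he : e ∈ S.seqs) {n : ℕ} {x : X} (h : IsIndex 𝕜 e n x) :
    x ∈ S.elements := by
  obtain ⟨b, hb, hx, -⟩ := h.exists_isName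
  exact hx.mem_elements he hb

theorem ratSpan_mem_elements (he : e ∈ S.seqs) (i : ℕ) : ratSpan 𝕜 e i ∈ S.elements :=
  IsName.mem_elements he (Computable.const i) fun k => by simp

/-- By the norm axiom, closeness of a rational combination to `x` is decidable up to a gap.
Searching for the first one that passes the test gives the name; density makes the search terminate.
-/
theorem exists_isName (he : S.IsGenerating e) {x : X} (hx : x ∈ S.elements) :
    ∃ b, Computable b ∧ IsName 𝕜 e b x := by
  classical
  have h := S.norm_computable _ (S.sub_mem (S.ratSpan_comp_mem he.1 Computable.id) hx)
  obtain ⟨P, hP, h'⟩ := h.exists_gap_test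
  have hex : ∀ k, ∃ i, P i k := by
    intro k
    obtain ⟨i, hi⟩ := he.denseRange_ratSpan.exists_dist_lt x
      (by positivity : (0 : ℝ) < 2⁻¹ ^ (k + 1))
    refine ⟨i, (h' i k).2 ?_⟩
    rwa [dist_comm, dist_eq_norm] at hi
  exact ⟨_, Computable.find (P := fun k i => P i k)
    (computablePred_comp hP (Computable.snd.pair Computable.fst)) hex,
    fun k => (h' _ k).1 (Nat.find_spec (hex k))⟩

theorem exists_index (he : S.IsGenerating e) {x : X} (hx : x ∈ S.elements) :
    ∃ n, IsIndex 𝕜 e n x := by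
  obtain ⟨b, hb, h⟩ := exists_isName he hx
  obtain ⟨s, -, hs⟩ := exists_index_of_isName (𝕜 := 𝕜) (e := e) (α := ℕ) (σ := fun _ => b)
    (hb.comp Computable.snd)
  exact ⟨s 0, hs 0 x h⟩

theorem IsIndex.unique {n : ℕ} {x y : X} (hx : IsIndex 𝕜 e n x) (hy : IsIndex 𝕜 e n y) :
    x = y := by
  have h0 : Tendsto (fun k : ℕ => (2⁻¹ : ℝ) ^ k) atTop (𝓝 0) :=
    tendsto_pow_atTop_nhds_zero_of_lt_one (by norm_num) (by norm_num)
  obtain ⟨b, -, hbx, hb⟩ := hx.exists_isName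
  have lim : ∀ z, (∀ k, ‖ratSpan 𝕜 e (b k) - z‖ < (2⁻¹ : ℝ) ^ k) →
      Tendsto (fun k => ratSpan 𝕜 e (b k)) atTop (𝓝 z) := fun z hz =>
    tendsto_iff_norm_sub_tendsto_zero.2
      (squeeze_zero (fun _ => norm_nonneg _) (fun k => (hz k).le) h0)
  refine tendsto_nhds_unique (lim x hbx) (lim y fun k => ?_)
  obtain ⟨m, hm, h⟩ := hy k
  rwa [Part.mem_unique hm (hb k)] at h

theorem countable_elements (he : S.IsGenerating e) : S.elements.Countable := by
  choose! n hn using fun x (hx : x ∈ S.elements) => exists_index he hx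
  exact Set.countable_of_injective_of_countable_image (f := n)
    (fun x hx y hy h => (hn x hx).unique (h ▸ hn y hy)) (Set.to_countable _)

theorem dense_elements (he : S.IsGenerating e) : Dense S.elements :=
  he.denseRange_ratSpan.mono (by rintro _ ⟨i, rfl⟩; exact ratSpan_mem_elements he.1 i)

end Space

/-! ### Following a sequence until a program halts. -/

section

/-- The stage `n`, cut off at the halting time of the program `c` on the input `0`. -/
def stage (c : Nat.Partrec.Code) : ℕ → ℕ
  | 0 => 0
  | n + 1 => if (Nat.Partrec.Code.evaln (stage c n) c 0).isSome then stage c n else n + 1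

theorem computable₂_stage : Computable₂ stage := by
  have h : Computable fun p : (Nat.Partrec.Code × ℕ) × ℕ × ℕ =>
      (Nat.Partrec.Code.evaln p.2.2 p.1.1 0).isSome :=
    Primrec.option_isSome.to_comp.comp (Nat.Partrec.Code.primrec_evaln.to_comp.comp
      (((Computable.snd.comp Computable.snd).pair (Computable.fst.comp Computable.fst)).pair
        (Computable.const 0)))
  refine (Computable.nat_rec (σ := ℕ) Computable.snd (Computable.const 0)
    (h := fun p q => bif (Nat.Partrec.Code.evaln q.2 p.1 0).isSome then q.2 else q.1 + 1)
    ?_).of_eq fun p => ?_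
  · exact Computable.cond h (Computable.snd.comp Computable.snd)
      (Computable.succ.comp (Computable.fst.comp Computable.snd))
  · obtain ⟨c, n⟩ := p
    induction n with
    | zero => rfl
    | succ n ih =>
      simp only at ih ⊢
      rw [ih, stage]
      simp only [cond_eq_ite]

theorem stage_eq_self {c : Nat.Partrec.Code}
    (h : ∀ j, (Nat.Partrec.Code.evaln j c 0).isSome = false) (n : ℕ) : stage c n = n := by
  cases n with
  | zero => rfl
  | succ n => simp [stage, h]

theorem stage_eq_min {c : Nat.Partrec.Code} {K : ℕ}
    (hK : (Nat.Partrec.Code.evaln K c 0).isSome = true)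
    (h : ∀ j < K, (Nat.Partrec.Code.evaln j c 0).isSome = false) (n : ℕ) :
    stage c n = min n K := by
  induction n with
  | zero => simp [stage]
  | succ n ih =>
    rw [stage, ih]
    rcases lt_or_ge n K with hn | hn
    · rw [min_eq_left hn.le, h n hn, min_eq_left hn]
      simp
    · rw [min_eq_right hn, hK, min_eq_right (by omega)]
      simp

theorem eval_dom_iff (c : Nat.Partrec.Code) :
    (c.eval 0).Dom ↔ ∃ j, (Nat.Partrec.Code.evaln j c 0).isSome = true := by
  rw [Part.dom_iff_mem]
  simp only [Nat.Partrec.Code.evaln_complete, Option.isSome_iff_exists, Option.mem_def]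
  exact exists_comm

variable {𝕜 X : Type*} [RCLike 𝕜] [NormedAddCommGroup X] [NormedSpace 𝕜 X]
  {S : ComputabilityStructure 𝕜 X} {e : ℕ → X} {T : X →. X}

/-! ### Continuity, boundedness and closedness of effective operators. -/

namespace IsEffectiveOperator

/-- The values of an effective operator on a uniform family of names can be approximated
uniformly. -/
theorem exists_approx (hT : IsEffectiveOperator S e T) {α : Type*} [Primcodable α]
    {σ : α → ℕ → ℕ} (hσ : Computable₂ σ) (hσ' : ∀ a, ∃ x, IsName 𝕜 e (σ a) x) (n : ℕ) :
    ∃ τ : α → ℕ, Computable τ ∧ ∀ a x, IsName 𝕜 e (σ a) x →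
      ∃ y ∈ T x, ‖ratSpan 𝕜 e (τ a) - y‖ < (2⁻¹ : ℝ) ^ n := by
  obtain ⟨f, hf, hf'⟩ := hT.effective
  obtain ⟨s, hs, hs'⟩ := exists_index_of_isName (𝕜 := 𝕜) (e := e) hσ
  have hg : Partrec fun a => (f (s a)).bind fun m => phi m n :=
    ((Partrec.nat_iff.2 hf).comp hs).bind
      (partrec₂_phi.comp Computable.snd (Computable.const n))
  have key : ∀ a x, IsName 𝕜 e (σ a) x → ∃ j ∈ (f (s a)).bind fun m => phi m n,
      ∃ y ∈ T x, ‖ratSpan 𝕜 e j - y‖ < (2⁻¹ : ℝ) ^ n := by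
    intro a x hx
    obtain ⟨m, hm, y, hy, hmy⟩ := hf' _ x (hs' a x hx)
    obtain ⟨j, hj, hjy⟩ := hmy n
    exact ⟨j, Part.mem_bind hm hj, y, hy, hjy⟩
  -- The computation is total because every `σ a` names some point.
  choose τ hτ using fun a => (hσ' a).elim fun x hx => (key a x hx).imp fun _ h => h.1
  refine ⟨τ, hg.of_eq_tot hτ, fun a x hx => ?_⟩
  obtain ⟨j, hj, h⟩ := key a x hx
  rwa [← Part.mem_unique hj (hτ a)]

theorem exists_mem (hT : IsEffectiveOperator S e T) (he : S.IsGenerating e) {x : X}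
    (hx : x ∈ S.elements) : ∃ y ∈ T x, y ∈ S.elements := by
  obtain ⟨n, hn⟩ := exists_index he hx
  obtain ⟨f, -, hf⟩ := hT.effective
  obtain ⟨m, -, y, hy, hmy⟩ := hf n x hn
  exact ⟨y, hy, hmy.mem_elements he.1⟩

theorem mem_elements (hT : IsEffectiveOperator S e T) (he : S.IsGenerating e) {x y : X}
    (hx : x ∈ S.elements) (hy : y ∈ T x) : y ∈ S.elements := by
  obtain ⟨z, hz, h⟩ := hT.exists_mem he hx
  rwa [Part.mem_unique hy hz]

/-- The values along a fast computable approximation of a computable element come close to the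
value at that element; otherwise the halting problem would be decidable. -/
theorem exists_norm_sub_lt (hT : IsEffectiveOperator S e T) (he : S.IsGenerating e) {b : ℕ → ℕ}
    (hb : Computable b) {x y : X} (hx : IsName 𝕜 e b x) (hy : y ∈ T x) {w : ℕ → X}
    (hw : ∀ k, w k ∈ T (ratSpan 𝕜 e (b k))) {ε : ℝ} (hε : 0 < ε) : ∃ k, ‖w k - y‖ < ε := by
  by_contra! hfar
  obtain ⟨n, hn⟩ := exists_pow_lt_of_lt_one (half_pos hε) (by norm_num : (2⁻¹ : ℝ) < 1)
  have hyS := hT.mem_elements he (hx.mem_elements he.1 hb) hy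
  obtain ⟨P, hP, hP'⟩ := (S.norm_computable _
    (S.sub_mem (S.ratSpan_comp_mem he.1 Computable.id) hyS)).exists_gap_test
  -- The shift to `k + 1` pays for freezing: a later approximant differs from the one at `k + 1` by
  -- less than `2 * 2⁻¹ ^ (k + 1) = 2⁻¹ ^ k`.
  have hσ : Computable₂ fun (c : Nat.Partrec.Code) k => b (stage c (k + 1)) :=
    hb.comp (computable₂_stage.comp Computable.fst (Computable.succ.comp Computable.snd))
  have hrun : ∀ c : Nat.Partrec.Code, ¬ (c.eval 0).Dom →
      IsName 𝕜 e (fun k => b (stage c (k + 1))) x := by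
    intro c hc k
    rw [eval_dom_iff] at hc
    push Not at hc
    beta_reduce
    rw [stage_eq_self (by simpa using hc)]
    exact (hx _).trans_le (pow_le_pow_of_le_one (by norm_num) (by norm_num) (Nat.le_succ k))
  have hhalt : ∀ c : Nat.Partrec.Code, (c.eval 0).Dom → ∃ K,
      IsName 𝕜 e (fun k => b (stage c (k + 1))) (ratSpan 𝕜 e (b K)) := by
    intro c hc
    rw [eval_dom_iff] at hc
    refine ⟨Nat.find hc, fun k => ?_⟩
    beta_reduce
    rw [stage_eq_min (Nat.find_spec hc) (fun j hj => by simpa using Nat.find_min hc hj)]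
    generalize Nat.find hc = K
    rcases le_total K (k + 1) with h | h
    · simp [min_eq_right h]
    · rw [min_eq_left h]
      have h1 := hx (k + 1)
      have h2 := hx K
      have h3 : (2⁻¹ : ℝ) ^ K ≤ 2⁻¹ ^ (k + 1) :=
        pow_le_pow_of_le_one (by norm_num) (by norm_num) h
      have h4 : (2⁻¹ : ℝ) ^ k = 2⁻¹ ^ (k + 1) + 2⁻¹ ^ (k + 1) := by rw [pow_succ]; ring
      have h5 := norm_sub_le_norm_sub_add_norm_sub (ratSpan 𝕜 e (b (k + 1))) x
        (ratSpan 𝕜 e (b K))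
      rw [norm_sub_rev x] at h5
      linarith
  -- Precision `n + 1` makes the gap test at `n` accept whenever `c` does not halt. If `c` halts,
  -- acceptance would put `w K` within `2 * 2⁻¹ ^ n < ε` of `y`. So the test decides the complement
  -- of the halting problem.
  obtain ⟨τ, hτ, hτ'⟩ := hT.exists_approx hσ (fun c => by
    by_cases hc : (c.eval 0).Dom
    · exact (hhalt c hc).imp' _ fun _ h => h
    · exact ⟨x, hrun c hc⟩) (n + 1)
  have hdec : ComputablePred fun c : Nat.Partrec.Code => P (τ c) n :=
    computablePred_comp hP (hτ.pair (Computable.const n))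
  refine ComputablePred.halting_problem_not_re 0 (hdec.of_eq fun c => ?_).to_re
  constructor
  · intro h hc
    obtain ⟨K, hK⟩ := hhalt c hc
    obtain ⟨v, hv, hv'⟩ := hτ' c _ hK
    rw [Part.mem_unique hv (hw K)] at hv'
    have h1 := (hP' _ _).1 h
    have h2 := hfar K
    have h3 := norm_sub_le_norm_sub_add_norm_sub (w K) (ratSpan 𝕜 e (τ c)) y
    rw [norm_sub_rev (w K) (ratSpan 𝕜 e (τ c))] at h3
    have h4 : (2⁻¹ : ℝ) ^ (n + 1) ≤ 2⁻¹ ^ n :=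
      pow_le_pow_of_le_one (by norm_num) (by norm_num) (Nat.le_succ n)
    simp only [id] at h1
    linarith
  · intro hc
    obtain ⟨v, hv, hv'⟩ := hτ' c _ (hrun c hc)
    rw [Part.mem_unique hv hy] at hv'
    exact (hP' _ _).2 hv'

theorem zero_mem (hT : IsEffectiveOperator S e T) (he : S.IsGenerating e) : (0 : X) ∈ T 0 := by
  obtain ⟨y, hy, -⟩ := hT.exists_mem he (ratSpan_mem_elements (𝕜 := 𝕜) he.1 0)
  simpa using hT.linear 0 0 .zero .zero _ _ y y hy hy

/-- If this fails, small combinations with large values exist at every scale. A recursive search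
collects them into a name of `0` that contradicts `exists_norm_sub_lt`. -/
theorem exists_bound_ratSpan (hT : IsEffectiveOperator S e T) (he : S.IsGenerating e) :
    ∃ δ > 0, ∀ i, ∀ y ∈ T (ratSpan 𝕜 e i), ‖ratSpan 𝕜 e i‖ < δ → ‖y‖ ≤ 4 := by
  classical
  by_contra! hbig
  have hself : ∀ i, IsName 𝕜 e (fun _ => i) (ratSpan 𝕜 e i) := fun i k => by simp
  obtain ⟨τ, hτ, hτ'⟩ := hT.exists_approx (α := ℕ) (σ := fun i _ => i) Computable.fst
    (fun i => ⟨_, hself i⟩) 2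
  obtain ⟨P, hP, hP'⟩ := (S.norm_computable _
    (S.ratSpan_comp_mem he.1 Computable.id)).exists_gap_test
  simp only [id] at hP'
  have hτT : ∀ i, ∀ y ∈ T (ratSpan 𝕜 e i), ‖ratSpan 𝕜 e (τ i) - y‖ < 1 / 4 := by
    intro i y hy
    obtain ⟨v, hv, hv'⟩ := hτ' i _ (hself i)
    rw [Part.mem_unique hy hv]
    norm_num at hv' ⊢
    exact hv'
  -- The values of `T` enter only through their computed approximations `τ`, accurate to `1 / 4`. A
  -- value of norm above 4 fails the test at 0, and failing it forces the approximation to have norm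
  -- at least `1 / 2`, hence the value to exceed `1 / 4`.
  have hdec : ComputablePred fun p : ℕ × ℕ => P p.2 p.1 ∧ ¬ P (τ p.2) 0 :=
    computablePred_and (computablePred_comp hP (Computable.snd.pair Computable.fst))
      (computablePred_comp hP ((hτ.comp Computable.snd).pair (Computable.const 0))).not
  have hex : ∀ k, ∃ i, P i k ∧ ¬ P (τ i) 0 := by
    intro k
    obtain ⟨i, y, hy, hi, hlarge⟩ := hbig (2⁻¹ ^ (k + 1)) (by positivity)
    refine ⟨i, (hP' _ _).2 hi, fun h => ?_⟩
    have h1 := (hP' _ _).1 h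
    have h2 := hτT i y hy
    have h3 := norm_sub_norm_le y (ratSpan 𝕜 e (τ i))
    rw [norm_sub_rev] at h3
    simp only [pow_zero] at h1
    linarith
  have hb := Computable.find (P := fun k i => P i k ∧ ¬ P (τ i) 0) hdec hex
  set b := fun k => Nat.find (hex k) with hbdef
  have hb' : ∀ k, P (b k) k ∧ ¬ P (τ (b k)) 0 := fun k => Nat.find_spec (hex k)
  choose w hw using fun k => hT.exists_mem he (ratSpan_mem_elements (𝕜 := 𝕜) he.1 (b k))
  obtain ⟨k, hk⟩ := hT.exists_norm_sub_lt he hb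
    (fun k => by simpa using (hP' _ _).1 (hb' k).1) (hT.zero_mem he) (fun k => (hw k).1)
    (by norm_num : (0 : ℝ) < 1 / 8)
  have h1 : (1 : ℝ) / 2 ≤ ‖ratSpan 𝕜 e (τ (b k))‖ := by
    by_contra! h
    exact (hb' k).2 ((hP' _ _).2 (by norm_num at h ⊢; exact h))
  have h2 := hτT _ _ (hw k).1
  have h3 := norm_sub_norm_le (ratSpan 𝕜 e (τ (b k))) (w k)
  rw [sub_zero] at hk
  linarith

/-- A late enough tail of a name of `x` stays in the ball of radius `δ`, and some value along it is
within 1 of `y`; hence the bound `4 + 1`. -/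
theorem exists_bound_elements (hT : IsEffectiveOperator S e T) (he : S.IsGenerating e) :
    ∃ δ > 0, ∀ x ∈ S.elements, ∀ y ∈ T x, ‖x‖ < δ → ‖y‖ ≤ 5 := by
  obtain ⟨δ, hδ, h⟩ := hT.exists_bound_ratSpan he
  refine ⟨δ, hδ, fun x hx y hy hxδ => ?_⟩
  obtain ⟨b, hb, hbx⟩ := exists_isName he hx
  obtain ⟨K, hK⟩ := exists_pow_lt_of_lt_one (sub_pos.2 hxδ) (by norm_num : (2⁻¹ : ℝ) < 1)
  choose w hw using fun k => hT.exists_mem he (ratSpan_mem_elements (𝕜 := 𝕜) he.1 (b (k + K)))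
  obtain ⟨k, hk⟩ := hT.exists_norm_sub_lt he (b := fun k => b (k + K))
    (hb.comp (computable_add Computable.id (Computable.const K)))
    (fun k => (hbx _).trans_le (pow_le_pow_of_le_one (by norm_num) (by norm_num)
      (Nat.le_add_right k K))) hy (fun k => (hw k).1) one_pos
  have h1 : ‖ratSpan 𝕜 e (b (k + K))‖ < δ := by
    have h2 := hbx (k + K)
    have h3 : (2⁻¹ : ℝ) ^ (k + K) ≤ 2⁻¹ ^ K :=
      pow_le_pow_of_le_one (by norm_num) (by norm_num) (Nat.le_add_left K k)
    have h4 := norm_sub_norm_le (ratSpan 𝕜 e (b (k + K))) x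
    linarith
  have h5 := h _ _ (hw k).1 h1
  have h6 := norm_sub_norm_le y (w k)
  rw [norm_sub_rev] at h6
  linarith

/-- The closure of the graph over the computable elements is the graph of a function. -/
theorem eq_of_mem_closure (hT : IsEffectiveOperator S e T) (he : S.IsGenerating e) {x y y' : X}
    (hy : (x, y) ∈ closure {p : X × X | p.1 ∈ S.elements ∧ p.2 ∈ T p.1})
    (hy' : (x, y') ∈ closure {p : X × X | p.1 ∈ S.elements ∧ p.2 ∈ T p.1}) : y = y' := by
  obtain ⟨δ, hδ, hbound⟩ := hT.exists_bound_elements he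
  obtain ⟨p, hp, hlim⟩ := mem_closure_iff_seq_limit.1 hy
  obtain ⟨q, hq, hlim'⟩ := mem_closure_iff_seq_limit.1 hy'
  -- Differences of the two sequences, multiplied by `N`, still tend to zero, so eventually the
  -- bound 5 applies to their values, which tend to `N • (y - y')`. Only natural numbers and their
  -- negatives serve as scalars, and these are computable.
  have hN : ∀ N : ℕ, N * ‖y - y'‖ ≤ 5 := by
    intro N
    have hc : IsComputableScalar (N : 𝕜) := .natCast N
    have hd : IsComputableScalar (-(N : 𝕜)) := IsComputableScalarSeq.neg (x := fun _ => (N : 𝕜)) hc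
    have h1 : Tendsto (fun n => (N : 𝕜) • (p n).1 + (-(N : 𝕜)) • (q n).1) atTop
        (𝓝 ((N : 𝕜) • x + (-(N : 𝕜)) • x)) :=
      ((hlim.fst_nhds).const_smul _).add ((hlim'.fst_nhds).const_smul _)
    have h2 : Tendsto (fun n => (N : 𝕜) • (p n).2 + (-(N : 𝕜)) • (q n).2) atTop
        (𝓝 ((N : 𝕜) • y + (-(N : 𝕜)) • y')) :=
      ((hlim.snd_nhds).const_smul _).add ((hlim'.snd_nhds).const_smul _)
    rw [← add_smul, add_neg_cancel, zero_smul] at h1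
    have h3 : ∀ᶠ n in atTop, ‖(N : 𝕜) • (p n).1 + (-(N : 𝕜)) • (q n).1‖ < δ := by
      have := h1.norm
      rw [norm_zero] at this
      exact this.eventually_lt_const hδ
    have h4 := le_of_tendsto h2.norm (h3.mono fun n hn => hbound _
      (S.smul_add_smul_mem (hp n).1 (hq n).1 hc hd) _
      (hT.linear _ _ hc hd _ _ _ _ (hp n).2 (hq n).2) hn)
    rwa [neg_smul, ← sub_eq_add_neg, ← smul_sub, norm_smul, RCLike.norm_natCast] at h4
  by_contra hne
  have hpos : 0 < ‖y - y'‖ := norm_sub_pos_iff.2 hne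
  obtain ⟨N, hN'⟩ := exists_nat_gt (5 / ‖y - y'‖)
  rw [div_lt_iff₀ hpos] at hN'
  exact absurd (hN N) (not_le.2 hN')

/-- The graph lies in the closure of its part over `X_k`, and that closure is single-valued. Both
closedness claims are instances, since all that is asked of the limit point is to lie in the domain.
-/
theorem mem_of_tendsto (hT : IsEffectiveOperator S e T) (he : S.IsGenerating e) {u v : ℕ → X}
    {x y z : X} (huv : ∀ n, v n ∈ T (u n)) (hu : Tendsto u atTop (𝓝 x))
    (hv : Tendsto v atTop (𝓝 y)) (hz : z ∈ T x) : y ∈ T x := by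
  have h1 : (x, y) ∈ closure {p : X × X | p.1 ∈ S.elements ∧ p.2 ∈ T p.1} :=
    isClosed_closure.mem_of_tendsto (hu.prodMk_nhds hv)
      (Eventually.of_forall fun n => hT.determined (huv n))
  rwa [hT.eq_of_mem_closure he h1 (hT.determined hz)]

theorem isClosedOn_elements (hT : IsEffectiveOperator S e T) (he : S.IsGenerating e) :
    IsClosedOn T S.elements := fun _ _ _ _ huv hx hu hv =>
  (hT.exists_mem he hx).elim fun _ hz => hT.mem_of_tendsto he huv hu hv hz.1

theorem isClosedOn_univ (hT : IsEffectiveOperator S e T) (he : S.IsGenerating e)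
    (hdom : T.Dom = Set.univ) : IsClosedOn T Set.univ := fun _ _ x _ huv _ hu hv =>
  (Part.dom_iff_mem.1 (show x ∈ T.Dom from hdom ▸ Set.mem_univ x)).elim fun _ hz =>
    hT.mem_of_tendsto he huv hu hv hz

end IsEffectiveOperator

/-! ### The identity on the span of the computable elements. -/

theorem mem_idOnSpan {x y : X} :
    y ∈ idOnSpan S x ↔ x ∈ Submodule.span 𝕜 S.elements ∧ y = x := by
  rw [idOnSpan, PFun.mem_res]
  simp [eq_comm]

theorem isEffectiveOperator_idOnSpan (he : S.IsGenerating e) :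
    IsEffectiveOperator S e (idOnSpan S) where
  linear c d _ _ x x' y y' hy hy' := by
    rw [mem_idOnSpan] at *
    obtain ⟨hx, rfl⟩ := hy
    obtain ⟨hx', rfl⟩ := hy'
    exact ⟨Submodule.add_mem _ (Submodule.smul_mem _ c hx) (Submodule.smul_mem _ d hx'), rfl⟩
  effective := ⟨Part.some, Nat.Partrec.some, fun n x hn => ⟨n, Part.mem_some n, x,
    mem_idOnSpan.2 ⟨Submodule.subset_span (hn.mem_elements he.1), rfl⟩, hn⟩⟩
  determined := by
    rintro ⟨x, y⟩ hxy
    obtain rfl : y = x := (mem_idOnSpan.1 hxy).2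
    obtain ⟨u, hu, hlim⟩ := mem_closure_iff_seq_limit.1 (dense_elements he y)
    exact mem_closure_of_tendsto (hlim.prodMk_nhds hlim) (Eventually.of_forall fun n =>
      ⟨hu n, mem_idOnSpan.2 ⟨Submodule.subset_span (hu n), rfl⟩⟩)

theorem dom_idOnSpan : (idOnSpan S).Dom = (Submodule.span 𝕜 S.elements : Set X) := by
  ext x
  rw [PFun.mem_dom]
  simp [mem_idOnSpan]

theorem not_isClosedOn_idOnSpan (he : S.IsGenerating e)
    (h : (idOnSpan S).Dom ≠ Set.univ) : ¬ IsClosedOn (idOnSpan S) Set.univ := by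
  refine fun hcl => h (Set.eq_univ_of_forall fun x => ?_)
  obtain ⟨u, hu, hlim⟩ := mem_closure_iff_seq_limit.1 (dense_elements he x)
  exact Part.dom_iff_mem.2 ⟨x, hcl u u x x
    (fun n => mem_idOnSpan.2 ⟨Submodule.subset_span (hu n), rfl⟩) (Set.mem_univ x) hlim hlim⟩

/-- A Banach space spanned by a countable set is finite-dimensional. -/
theorem finiteDimensional_of_span_countable [CompleteSpace X] {s : Set X} (hs : s.Countable)
    (h : Submodule.span 𝕜 s = ⊤) : FiniteDimensional 𝕜 X := by
  rcases s.eq_empty_or_nonempty with rfl | hne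
  · rw [Submodule.span_empty] at h
    exact Module.finite_def.2 (h ▸ Submodule.fg_bot)
  obtain ⟨x, rfl⟩ := hs.exists_eq_range hne
  let V : ℕ → Submodule 𝕜 X := fun n => Submodule.span 𝕜 (x '' Set.Iio n)
  have hfin : ∀ n, FiniteDimensional 𝕜 (V n) := fun n =>
    FiniteDimensional.span_of_finite 𝕜 ((Set.finite_Iio n).image x)
  have hmono : Monotone V := fun m n hmn =>
    Submodule.span_mono (Set.image_mono (Set.Iio_subset_Iio hmn))
  have hU : ⋃ n, (V n : Set X) = Set.univ := by
    rw [← Submodule.coe_iSup_of_directed V hmono.directed_le, ← Submodule.top_coe (R := 𝕜), ← h]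
    congr 1
    refine le_antisymm (iSup_le fun n => Submodule.span_mono (Set.image_subset_range _ _)) ?_
    rw [Submodule.span_le]
    rintro _ ⟨n, rfl⟩
    exact Submodule.mem_iSup_of_mem (n + 1) (Submodule.subset_span ⟨n, Nat.lt_succ_self n, rfl⟩)
  -- Baire's theorem: one of the closed subspaces `V n` has an interior point, so it is the whole
  -- space.
  obtain ⟨n, hn⟩ := nonempty_interior_of_iUnion_of_closed
    (fun n => (V n).closed_of_finiteDimensional) hU
  have htop : V n = ⊤ := (V n).eq_top_of_nonempty_interior' hn
  exact Module.finite_def.2 (htop ▸ Module.Finite.iff_fg.1 (hfin n))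

theorem dom_idOnSpan_ne_univ [CompleteSpace X] (he : S.IsGenerating e)
    (h : ¬ FiniteDimensional 𝕜 X) : (idOnSpan S).Dom ≠ Set.univ := by
  rw [dom_idOnSpan]
  exact fun huniv => h (finiteDimensional_of_span_countable (countable_elements he)
    (SetLike.coe_injective (by rw [huniv, Submodule.top_coe])))

end

/-! ### The effective Banach space of null sequences. -/

section

variable {𝕜 : Type*} [RCLike 𝕜]

theorem IsComputableScalarSeq₂.comp₂ {x : ℕ → ℕ → 𝕜} (hx : IsComputableScalarSeq₂ x)
    {f g : ℕ → ℕ} (hf : Computable f) (hg : Computable g) :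
    IsComputableScalarSeq fun n => x (f n) (g n) := by
  have h := IsComputableScalarSeq.comp hx (computable_pair hf hg)
  simpa using h

namespace NullSequence

theorem norm_apply_le (f : C₀(ℕ, 𝕜)) (i : ℕ) : ‖f i‖ ≤ ‖f‖ :=
  f.toBCF.norm_coe_le_norm i

theorem norm_le {f : C₀(ℕ, 𝕜)} {C : ℝ} (hC : 0 ≤ C) (h : ∀ i, ‖f i‖ ≤ C) : ‖f‖ ≤ C :=
  (BoundedContinuousFunction.norm_le (f := f.toBCF) hC).2 h

theorem tendsto_zero (f : C₀(ℕ, 𝕜)) : Tendsto f atTop (𝓝 0) := by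
  have h := f.zero_at_infty'
  rwa [cocompact_eq_cofinite, Nat.cofinite_eq_atTop] at h

/-- The null sequences, as a subspace of all sequences. -/
def toFun (𝕜 : Type*) [RCLike 𝕜] : C₀(ℕ, 𝕜) →ₗ[𝕜] ℕ → 𝕜 where
  toFun f := f
  map_add' _ _ := rfl
  map_smul' _ _ := rfl

theorem sum_apply {ι : Type*} (s : Finset ι) (f : ι → C₀(ℕ, 𝕜)) (j : ℕ) :
    (∑ i ∈ s, f i) j = ∑ i ∈ s, f i j := by
  change toFun 𝕜 (∑ i ∈ s, f i) j = _
  rw [map_sum, Finset.sum_apply]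
  rfl

/-- The unit vectors of the space of null sequences. -/
def unitVector (𝕜 : Type*) [RCLike 𝕜] (n : ℕ) : C₀(ℕ, 𝕜) where
  toFun := Pi.single n 1
  continuous_toFun := continuous_of_discreteTopology
  zero_at_infty' := by
    rw [cocompact_eq_cofinite, Nat.cofinite_eq_atTop]
    refine tendsto_const_nhds.congr' ((eventually_gt_atTop n).mono fun i hi => ?_)
    exact (Pi.single_eq_of_ne (M := fun _ => 𝕜) hi.ne' 1).symm

theorem unitVector_apply (n i : ℕ) : unitVector 𝕜 n i = if i = n then 1 else 0 := by
  change (Pi.single n 1 : ℕ → 𝕜) i = _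
  rw [Pi.single_apply]

theorem not_finiteDimensional (𝕜 : Type*) [RCLike 𝕜] : ¬ FiniteDimensional 𝕜 C₀(ℕ, 𝕜) := by
  intro hfin
  have h : LinearIndependent 𝕜 (unitVector 𝕜) :=
    LinearIndependent.of_comp (toFun 𝕜) (Pi.linearIndependent_single_one ℕ 𝕜)
  exact not_finite_iff_infinite.2 inferInstance h.finite

theorem dense_span_unitVector (𝕜 : Type*) [RCLike 𝕜] :
    Dense (Submodule.span 𝕜 (Set.range (unitVector 𝕜)) : Set C₀(ℕ, 𝕜)) := by
  intro f
  rw [Metric.mem_closure_iff]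
  intro ε hε
  obtain ⟨N, hN⟩ := Metric.tendsto_atTop.1 (tendsto_zero f) (ε / 2) (half_pos hε)
  refine ⟨∑ i ∈ Finset.range N, f i • unitVector 𝕜 i, Submodule.sum_mem _ fun i _ =>
    Submodule.smul_mem _ _ (Submodule.subset_span ⟨i, rfl⟩), ?_⟩
  rw [dist_eq_norm]
  refine (norm_le (half_pos hε).le fun j => ?_).trans_lt (half_lt_self hε)
  rw [ZeroAtInftyContinuousMap.sub_apply, sum_apply]
  simp only [ZeroAtInftyContinuousMap.smul_apply, unitVector_apply, smul_eq_mul, mul_ite, mul_one,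
    mul_zero, Finset.sum_ite_eq, Finset.mem_range]
  split_ifs with hj
  · simpa using (half_pos hε).le
  · have := hN j (not_lt.1 hj)
    rw [dist_zero_right] at this
    simpa using this.le

/-- The computable sequences of null sequences: the entries are uniformly computable, and the
convergence to zero is effective. -/
def computableSeqs (𝕜 : Type*) [RCLike 𝕜] : Set (ℕ → C₀(ℕ, 𝕜)) :=
  {x | IsComputableScalarSeq₂ (fun n i => x n i) ∧
    ∃ g : ℕ → ℕ → ℕ, Computable₂ g ∧ ∀ n k i, g n k ≤ i → ‖x n i‖ ≤ (2⁻¹ : ℝ) ^ k}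

theorem unitVector_mem : unitVector 𝕜 ∈ computableSeqs 𝕜 := by
  refine ⟨?_, fun n _ => n + 1, Computable.succ.comp Computable.fst, fun n k i hi => ?_⟩
  · simp only [unitVector_apply]
    exact IsComputableScalar.one.diagonal
  · rw [unitVector_apply, if_neg (Nat.lt_of_succ_le hi).ne']
    simp

theorem linear_mem {x y : ℕ → C₀(ℕ, 𝕜)} (hx : x ∈ computableSeqs 𝕜) (hy : y ∈ computableSeqs 𝕜)
    {a b : ℕ → ℕ → 𝕜} (ha : IsComputableScalarSeq₂ a) (hb : IsComputableScalarSeq₂ b) {d : ℕ → ℕ}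
    (hd : Computable d) :
    (fun n => ∑ k ∈ Finset.range (d n + 1), (a n k • x k + b n k • y k)) ∈ computableSeqs 𝕜 := by
  obtain ⟨hxc, g, hg, hgx⟩ := hx
  obtain ⟨hyc, g', hg', hgy⟩ := hy
  obtain ⟨A, hA, hAa⟩ := (IsComputableScalarSeq.norm ha).exists_bound
  obtain ⟨B, hB, hBb⟩ := (IsComputableScalarSeq.norm hb).exists_bound
  have hAa' : ∀ n k, ‖a n k‖ ≤ A (Nat.pair n k) := fun n k => by simpa using hAa (Nat.pair n k)
  have hBb' : ∀ n k, ‖b n k‖ ≤ B (Nat.pair n k) := fun n k => by simpa using hBb (Nat.pair n k)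
  have happ : ∀ n i, (∑ k ∈ Finset.range (d n + 1), (a n k • x k + b n k • y k)) i =
      ∑ k ∈ Finset.range (d n + 1), (a n k * x k i + b n k * y k i) := fun n i => by
    rw [sum_apply]; rfl
  have hd' := Computable.succ.comp hd
  let D : ℕ → ℕ := fun n =>
    ∑ k ∈ Finset.range (d n + 1), (A (Nat.pair n k) + B (Nat.pair n k))
  have hpair : Computable fun p : ℕ × ℕ => Nat.pair p.1 p.2 :=
    computable_pair Computable.fst Computable.snd
  have hD : Computable D :=
    computable_sum hd' (computable_add (hA.comp hpair) (hB.comp hpair))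
  -- `D n` bounds the total size of the coefficients, and `D n * 2⁻¹ ^ D n ≤ 1`, so precision `N + D
  -- n` in each term suffices. The sum of the moduli dominates each of them.
  refine ⟨?_, fun n N => ∑ k ∈ Finset.range (d n + 1), (g k (N + D n) + g' k (N + D n)), ?_,
    fun n N i hi => ?_⟩
  · simp only [happ]
    have h1 := computable_unpair_fst Computable.id
    have h2 := computable_unpair_snd Computable.id
    have h11 := computable_unpair_fst h1
    have h12 := computable_unpair_snd h1
    exact IsComputableScalarSeq.sum
      (x := fun m k => a m.unpair.1 k * x k m.unpair.2 + b m.unpair.1 k * y k m.unpair.2)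
      (((ha.comp₂ h11 h2).mul (hxc.comp₂ h2 h12)).add ((hb.comp₂ h11 h2).mul (hyc.comp₂ h2 h12)))
      (hd'.comp h1)
  · have hk : Computable fun p : (ℕ × ℕ) × ℕ => p.1.2 + D p.1.1 :=
      computable_add (Computable.snd.comp Computable.fst)
        (hD.comp (Computable.fst.comp Computable.fst))
    exact computable_sum (hd'.comp Computable.fst)
      (computable_add (hg.comp Computable.snd hk) (hg'.comp Computable.snd hk))
  · rw [happ]
    have hterm : ∀ k ∈ Finset.range (d n + 1), ‖a n k * x k i + b n k * y k i‖ ≤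
        ((A (Nat.pair n k) + B (Nat.pair n k) : ℕ) : ℝ) * 2⁻¹ ^ (N + D n) := by
      intro k hk
      have hle := (Finset.single_le_sum (f := fun k => g k (N + D n) + g' k (N + D n))
        (fun _ _ => Nat.zero_le _) hk).trans hi
      have h1 := hgx k (N + D n) i ((Nat.le_add_right _ _).trans hle)
      have h2 := hgy k (N + D n) i ((Nat.le_add_left _ _).trans hle)
      refine (norm_add_le _ _).trans ?_
      rw [norm_mul, norm_mul, Nat.cast_add, add_mul]
      have := hAa' n k
      have := hBb' n k
      gcongr
    refine (norm_sum_le_of_le _ hterm).trans ?_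
    rw [← Finset.sum_mul, ← Nat.cast_sum, pow_add, mul_left_comm]
    refine mul_le_of_le_one_right (by positivity) ?_
    rw [inv_pow, ← div_eq_mul_inv, div_le_one (by positivity)]
    exact_mod_cast (Nat.lt_two_pow_self (n := D n)).le

theorem limit_mem {x : ℕ → ℕ → C₀(ℕ, 𝕜)} {y : ℕ → C₀(ℕ, 𝕜)}
    (hx : (fun m => x m.unpair.1 m.unpair.2) ∈ computableSeqs 𝕜) {g : ℕ → ℕ → ℕ}
    (hg : Computable₂ g) (h : ∀ n N k, g n N ≤ k → ‖x n k - y n‖ ≤ (2⁻¹ : ℝ) ^ N) :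
    y ∈ computableSeqs 𝕜 := by
  obtain ⟨hxc, G, hG, hGx⟩ := hx
  have hconv : ∀ n N i, ‖x n (g n N) i - y n i‖ ≤ (2⁻¹ : ℝ) ^ N := fun n N i =>
    (norm_apply_le (x n (g n N) - y n) i).trans (h n N _ le_rfl)
  have h1 := computable_unpair_fst Computable.id
  have h2 := computable_unpair_snd Computable.id
  have hcoord := hxc.comp₂ (computable_pair (computable_unpair_fst h1) h2)
    (computable_unpair_snd h1)
  simp only [Nat.unpair_pair, id] at hcoord
  have hg' : Computable₂ fun m N : ℕ => g m.unpair.1 N :=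
    hg.comp (computable_unpair_fst Computable.fst) Computable.snd
  refine ⟨⟨IsComputableRealSeq.lim
      (x := fun m k => RCLike.re (x m.unpair.1 k m.unpair.2)) hcoord.1 hg' fun m N => ?_,
    IsComputableRealSeq.lim
      (x := fun m k => RCLike.im (x m.unpair.1 k m.unpair.2)) hcoord.2 hg' fun m N => ?_⟩,
    -- Half of the tolerance goes to replacing `y n` by an approximant, half to the tail of that
    -- approximant.
    fun n N => G (Nat.pair n (g n (N + 1))) (N + 1), ?_, fun n N i hi => ?_⟩
  · rw [← map_sub]
    exact (RCLike.abs_re_le_norm _).trans (hconv _ _ _)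
  · rw [← map_sub]
    exact (RCLike.abs_im_le_norm _).trans (hconv _ _ _)
  · have hN : Computable fun p : ℕ × ℕ => p.2 + 1 := Computable.succ.comp Computable.snd
    exact hG.comp (computable_pair Computable.fst (hg.comp Computable.fst hN)) hN
  · have h3 := hGx _ _ i hi
    have h4 := hconv n (N + 1) i
    beta_reduce at h3
    rw [Nat.unpair_pair] at h3
    have h5 : (2⁻¹ : ℝ) ^ N = 2⁻¹ ^ (N + 1) + 2⁻¹ ^ (N + 1) := by rw [pow_succ]; ring
    have h6 := norm_sub_norm_le (y n i) (x n (g n (N + 1)) i)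
    rw [norm_sub_rev] at h6
    linarith

/-- After multiplication by `k`, the entries from `g n k` on contribute at most `k * 2⁻¹ ^ k ≤ 1`,
so a finite maximum approximates the supremum up to a constant error. Truncated subtraction is
harmless because norms are nonnegative. -/
theorem norm_computable {x : ℕ → C₀(ℕ, 𝕜)} (hx : x ∈ computableSeqs 𝕜) :
    IsComputableRealSeq fun n => ‖x n‖ := by
  obtain ⟨hxc, g, hg, hgx⟩ := hx
  obtain ⟨p, q, hp, hq, h⟩ := (IsComputableScalarSeq.norm hxc).scaled
  have hn : Computable fun a : (ℕ × ℕ) × ℕ => Nat.pair a.1.1 a.2 :=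
    computable_pair (Computable.fst.comp Computable.fst) Computable.snd
  have hk : Computable fun a : (ℕ × ℕ) × ℕ => a.1.2 := Computable.snd.comp Computable.fst
  refine IsComputableRealSeq.of_scaled
    (p := fun n k => (Finset.range (g n k)).sup fun i => p (Nat.pair n i) k - q (Nat.pair n i) k)
    (q := fun _ _ => 0) (C := fun _ => 2)
    (computable_sup hg (computable_sub (hp.comp hn hk) (hq.comp hn hk)))
    (Computable.const 0) (Computable.const 2) fun n k hk => ?_
  have hentry : ∀ i, |(k : ℝ) * ‖x n i‖ - ((p (Nat.pair n i) k : ℝ) - q (Nat.pair n i) k)| ≤ 2 :=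
    fun i => by simpa using h (Nat.pair n i) k hk
  set M := (Finset.range (g n k)).sup fun i => p (Nat.pair n i) k - q (Nat.pair n i) k with hM
  have hk0 : (0 : ℝ) < k := by positivity
  have hupper : ∀ i, (k : ℝ) * ‖x n i‖ ≤ M + 2 := by
    intro i
    rcases lt_or_ge i (g n k) with hi | hi
    · have h1 := Finset.le_sup (f := fun i => p (Nat.pair n i) k - q (Nat.pair n i) k)
        (Finset.mem_range.2 hi)
      have h2 : (p (Nat.pair n i) k : ℝ) ≤ M + q (Nat.pair n i) k := by
        exact_mod_cast Nat.sub_le_iff_le_add.1 h1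
      linarith [(abs_le.1 (hentry i)).2]
    · have h1 : (k : ℝ) * ‖x n i‖ ≤ k * 2⁻¹ ^ k := by gcongr; exact hgx n k i hi
      have h2 : (k : ℝ) * (2⁻¹ : ℝ) ^ k ≤ 1 := by
        rw [inv_pow, ← div_eq_mul_inv, div_le_one (by positivity)]
        exact_mod_cast Nat.lt_two_pow_self.le
      have h3 : (0 : ℝ) ≤ M := by positivity
      linarith
  have hlower : (M : ℝ) ≤ k * ‖x n‖ + 2 := by
    have hnn : (0 : ℝ) ≤ k * ‖x n‖ + 2 := by positivity
    rw [← Nat.le_floor_iff hnn]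
    refine Finset.sup_le fun i _ => ?_
    rw [Nat.le_floor_iff hnn]
    have h1 := (abs_le.1 (hentry i)).1
    have h2 : (k : ℝ) * ‖x n i‖ ≤ k * ‖x n‖ := by gcongr; exact norm_apply_le _ _
    rcases le_total (p (Nat.pair n i) k) (q (Nat.pair n i) k) with hle | hle
    · rw [Nat.sub_eq_zero_of_le hle]
      simpa using hnn
    · rw [Nat.cast_sub hle]
      linarith
  have hnorm : (k : ℝ) * ‖x n‖ ≤ M + 2 := by
    rw [← le_div_iff₀' hk0]
    exact norm_le (by positivity) fun i => by rw [le_div_iff₀' hk0]; exact hupper i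
  push_cast
  rw [abs_le]
  constructor <;> linarith

/-- The computability structure of the space of null sequences. -/
def computabilityStructure (𝕜 : Type*) [RCLike 𝕜] : ComputabilityStructure 𝕜 C₀(ℕ, 𝕜) where
  seqs := computableSeqs 𝕜
  nonempty := ⟨_, unitVector_mem⟩
  linear_mem _ hx _ hy _ _ ha hb _ hd := linear_mem hx hy ha hb hd
  limit_mem _ _ hx := fun ⟨_, hg, h⟩ => limit_mem hx hg h
  norm_computable _ hx := norm_computable hx

theorem isGenerating_unitVector (𝕜 : Type*) [RCLike 𝕜] :
    (computabilityStructure 𝕜).IsGenerating (unitVector 𝕜) :=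
  ⟨unitVector_mem, dense_span_unitVector 𝕜⟩

end NullSequence

theorem idOnSpan_properties {X : Type*} [NormedAddCommGroup X] [NormedSpace 𝕜 X] [CompleteSpace X]
    {S : ComputabilityStructure 𝕜 X} {e : ℕ → X} (he : S.IsGenerating e)
    (h : ¬ FiniteDimensional 𝕜 X) :
    IsEffectiveOperator S e (idOnSpan S) ∧ ¬ IsClosedOn (idOnSpan S) Set.univ ∧
      (idOnSpan S).Dom ≠ Set.univ :=
  ⟨isEffectiveOperator_idOnSpan he, not_isClosedOn_idOnSpan he (dom_idOnSpan_ne_univ he h),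
    dom_idOnSpan_ne_univ he h⟩

end

end EffectiveBanach

end

theorem theorem41 (𝕜 : Type u) [RCLike 𝕜] :
    (∀ (X : Type v) [NormedAddCommGroup X] [NormedSpace 𝕜 X] [CompleteSpace X]
      (S : EffectiveBanach.ComputabilityStructure 𝕜 X) (e : ℕ → X), S.IsGenerating e →
      (∀ T : X →. X, EffectiveBanach.IsEffectiveOperator S e T →
        EffectiveBanach.IsClosedOn T S.elements ∧
        (T.Dom = Set.univ → EffectiveBanach.IsClosedOn T Set.univ) ∧
        (¬ EffectiveBanach.IsClosedOn T Set.univ → T.Dom ≠ Set.univ)) ∧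
      (¬ FiniteDimensional 𝕜 X →
        EffectiveBanach.IsEffectiveOperator S e (EffectiveBanach.idOnSpan S) ∧
        ¬ EffectiveBanach.IsClosedOn (EffectiveBanach.idOnSpan S) Set.univ ∧
        (EffectiveBanach.idOnSpan S).Dom ≠ Set.univ)) ∧
    (∃ (X : Type u) (_ : NormedAddCommGroup X) (_ : NormedSpace 𝕜 X) (_ : CompleteSpace X)
      (S : EffectiveBanach.ComputabilityStructure 𝕜 X) (e : ℕ → X), S.IsGenerating e ∧
      EffectiveBanach.IsEffectiveOperator S e (EffectiveBanach.idOnSpan S) ∧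
      ¬ EffectiveBanach.IsClosedOn (EffectiveBanach.idOnSpan S) Set.univ ∧
      (EffectiveBanach.idOnSpan S).Dom ≠ Set.univ) := by
  refine ⟨fun X _ _ _ S e he => ⟨fun T hT => ⟨hT.isClosedOn_elements he, hT.isClosedOn_univ he,
    fun hcl hdom => hcl (hT.isClosedOn_univ he hdom)⟩,
    EffectiveBanach.idOnSpan_properties he⟩, ?_⟩
  have he := EffectiveBanach.NullSequence.isGenerating_unitVector 𝕜
  exact ⟨_, _, _, inferInstance, _, _, he, EffectiveBanach.idOnSpan_properties he
    (EffectiveBanach.NullSequence.not_finiteDimensional 𝕜)⟩
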